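/- Let $p$ be a prime. A quadratic form over $\mathbb{F}_p$ in $n$ variables is a polynomial $Q=\sum_{1\le i\le j\le n}a_{ij}x_ix_j$ with $a_{ij}\in\mathbb{F}_p$. It is regular if there is no non-zero vector $x$ with $Q(x)=0$ and $Q(x+y)-Q(x)-Q(y)=0$ for all $y$, and anisotropic if $Q(x)\ne 0$ for all $x\neq 0$. The form $Q$ belongs to the class $[l,m,n]$ if $2l+m\le n$ and, with $r=n-2l-m$, it is equivalent under $\mathrm{GL}_n(\mathbb{F}_p)$ to a form $$\sum_{k=1}^{l}x_{r+2k-1}x_{r+2k}+f(x_{r+2l+1},\dots,x_n),$$ where $f$ is a regular anisotropic form of dimension $m$. Let the coefficients $a_{ij}$ of $Q$ be independent and uniformly distributed on $\mathbb{F}_p$. Let $\pi_0(l,m,n)$ be the probability that $Q$ belongs to the class $[l,m,n]$; for $n\ge 1$ let $\pi_1(l,m,n)$ be the conditional probability of this event given that $a_{11}\neq 0$; and for $n\ge 2$ let $\pi_2(l,m,n)$ be its conditional probability given that $a_{11}x_1^2+a_{12}x_1x_2+a_{22}x_2^2$ is regular anisotropic. (So $\pi_i(l,m,n)=0$ if $2l+m>n$.)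 For $i,j\in\{0,1,2\}$ and $n\ge i+j$ put $d=\lfloor\frac{n+1-i-j}{2}\rfloor$ and $$\phi(i,j,n)=\big((j-1)p^d+(i-1)\big)\prod_{r=1}^{d}\frac{p^{2r-1}-1}{p^{2r}-1},$$ $$\psi(i,j,n)=\frac{\big((j-1)p^d+(i-1)\big)\big((j-1)p^{d+2}-(i-1)\big)-\delta_{i1}\,p+\delta_{j1}\,p^{2d+1}}{(p+1)(p^{2d+1}-1)},$$ where $\delta_{ab}$ is the Kronecker delta. Then for all $i,j\in\{0,1,2\}$ and $n\ge i+j$, $$\phi(i,j,n)=\sum_{l\ge 0}\sum_{m=0}^{2}\pi_i(l,m,n-j)\,\phi(j,m,n-2l),$$ and if $n$ is even then $$\psi(i,j,n)=\sum_{l\ge 0}\sum_{m=0}^{2}\pi_i(l,m,n-j)\,\psi(j,m,n-2l).$$ (All but finitely many terms vanish; a term with $\pi_i(l,m,n-j)=0$ counts as $0$ even where $\phi(j,m,n-2l)$ or $\psi(j,m,n-2l)$ is undefined.) -/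

import Mathlib

/-- Coefficient families `(a_{ij})_{i ≤ j}` of quadratic forms in `n` variables
(the indices run over `0, …, n - 1` in place of `1, …, n`). -/
abbrev QFCoeffs (F : Type*) (n : ℕ) : Type _ :=
  {ij : Fin n × Fin n // ij.1 ≤ ij.2} → F

/-- The quadratic form `∑_{i ≤ j} a_{ij} x_i x_j`. -/
def QFCoeffs.toForm {F : Type*} [Field F] {n : ℕ} (a : QFCoeffs F n) :
    QuadraticForm F (Fin n → F) :=
  ∑ ij : {ij : Fin n × Fin n // ij.1 ≤ ij.2}, a ij • QuadraticMap.proj ij.1.1 ij.1.2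

/-- The coefficients `a_{ij}` involving only the first `k` of the `n` variables. -/
def QFCoeffs.leading {F : Type*} {n k : ℕ} (h : k ≤ n) (a : QFCoeffs F n) : QFCoeffs F k :=
  fun ij => a ⟨(Fin.castLE h ij.1.1, Fin.castLE h ij.1.2), ij.2⟩

/-- A quadratic form is regular and anisotropic: its radical (the vectors `x` with `Q x = 0` that
are orthogonal to everything, for the polar form) is zero, and no non-zero vector `x` has
`Q x = 0`. -/
def IsRegularAnisotropic {F : Type*} [Field F] {k : ℕ} (Q : QuadraticForm F (Fin k → F)) : Prop :=
  Q.radical = ⊥ ∧ Q.Anisotropic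

/-- The form `∑_{k=1}^{l} x_{r+2k-1} x_{r+2k} + f(x_{r+2l+1}, …, x_n)` in `n` variables, where
`r = n - 2l - m`. -/
def splitForm {F : Type*} [Field F] (l m n : ℕ) (h : 2 * l + m ≤ n)
    (f : QuadraticForm F (Fin m → F)) : QuadraticForm F (Fin n → F) :=
  (∑ k : Fin l, QuadraticMap.proj
      (⟨(n - 2 * l - m) + 2 * k, by omega⟩ : Fin n)
      (⟨(n - 2 * l - m) + 2 * k + 1, by omega⟩ : Fin n)) +
    f.comp (LinearMap.funLeft F F
      (fun t : Fin m => (⟨(n - 2 * l - m) + 2 * l + t, by omega⟩ : Fin n)))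

/-- The quadratic form `Q` in `n` variables belongs to the class `[l, m, n]`. -/
def InClass {F : Type*} [Field F] (l m n : ℕ) (Q : QuadraticForm F (Fin n → F)) : Prop :=
  ∃ (h : 2 * l + m ≤ n) (f : QuadraticForm F (Fin m → F)),
    IsRegularAnisotropic f ∧ Q.Equivalent (splitForm l m n h f)

/-- The condition on the coefficients that defines `π_i`: no condition for `i = 0`, `a_{11} ≠ 0` for
`i = 1`, and `a_{11} x_1² + a_{12} x_1 x_2 + a_{22} x_2²` regular anisotropic for `i = 2`. -/
def LeadingCondition {F : Type*} [Field F] {n : ℕ} (a : QFCoeffs F n) : ℕ → Prop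
  | 0 => True
  | 1 => ∃ h : 0 < n, a ⟨(⟨0, h⟩, ⟨0, h⟩), le_rfl⟩ ≠ 0
  | 2 => ∃ h : 2 ≤ n, IsRegularAnisotropic (a.leading h).toForm
  | _ => False

/-- `π_i(l, m, n)`: the conditional probability that a uniformly random quadratic form in `n`
variables over `𝔽_p` belongs to the class `[l, m, n]`, given the condition indexed by `i`. -/
noncomputable def classProb (p : ℕ) [Fact p.Prime] (i l m n : ℕ) : ℝ :=
  (Nat.card {a : QFCoeffs (ZMod p) n // LeadingCondition a i ∧ InClass l m n a.toForm} : ℝ) /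
    (Nat.card {a : QFCoeffs (ZMod p) n // LeadingCondition a i} : ℝ)

/-- `φ(i, j, n)`, for `n ≥ i + j`. -/
noncomputable def phiFun (p : ℝ) (i j n : ℕ) : ℝ :=
  let d : ℕ := (n + 1 - i - j) / 2
  (((j : ℝ) - 1) * p ^ d + ((i : ℝ) - 1)) *
    ∏ r ∈ Finset.Icc 1 d, (p ^ (2 * r - 1) - 1) / (p ^ (2 * r) - 1)

/-- `ψ(i, j, n)`, for `n ≥ i + j`. -/
noncomputable def psiFun (p : ℝ) (i j n : ℕ) : ℝ :=
  let d : ℕ := (n + 1 - i - j) / 2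
  ((((j : ℝ) - 1) * p ^ d + ((i : ℝ) - 1)) * (((j : ℝ) - 1) * p ^ (d + 2) - ((i : ℝ) - 1))
      - (if i = 1 then 1 else 0) * p + (if j = 1 then 1 else 0) * p ^ (2 * d + 1)) /
    ((p + 1) * (p ^ (2 * d + 1) - 1))

/-! Over a finite field every quadratic form is an orthogonal sum of a zero form in `r` variables,
some hyperbolic planes and an anisotropic form in `m ≤ 2` variables, and the form determines `(m,
r)`. Adding one variable with uniformly random new coefficients makes `(m, r)` a Markov chain
(`HasType.sum_formType_extForm`). With probability `1 - q ^ r`, where `q = 1/p`, the new linear part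
is nonzero on the radical: the radical loses a dimension to a new hyperbolic plane. Otherwise only
the anisotropic part is extended. The leading condition forces the state `(i, 0)` after `i`
variables, so each sum over classes is the value at `(i, 0)` of the `t`-th power of the transition
operator, `t = n - i - j` (`hasSum_classProb`).

From `m = 1` the chain moves to `0` and `2` with equal probability. Hence functions `A r + (m - 1) *
B r` are preserved, with `radStep q` acting on `A` and `altStep q` on `B` (`typeStep_iterate`). As
functions of `(m, r)`, the values of φ at `(j, m, r + j + m)` have this shape, and so do those of ψ
where `r + j + m` is even. It remains to evaluate powers of the two operators at `0` on a few
explicit functions.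

Each operator commutes up to a scalar with a shift, which gives a recurrence in `t` for the values
at `0`, with an inhomogeneous term built from the shifted function (`altStep_pow_recurrence`,
`radStep_pow_recurrence`). On the functions needed, the shift is expressed through the step operator
itself, so the recurrence closes and is solved by a product. The remaining case, `radStep` on the
function from φ, reduces to `altStep` by an intertwining relation (`radStep_ceilProd_shift`). -/

/-! ### Step operators and the shifts that commute with them up to a scalar -/

/-- The transition operator of the corank of a random alternating-type form, with parameter `x`. -/
def altStep (x : ℝ) : Module.End ℝ (ℕ → ℝ) where
  toFun u s := (1 - x ^ s) * u (s - 1) + x ^ (s + 1) * u (s + 1)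
  map_add' u v := by ext s; simp only [Pi.add_apply]; ring
  map_smul' c u := by ext s; simp only [Pi.smul_apply, smul_eq_mul, RingHom.id_apply]; ring

/-- The transition operator of the dimension of the radical of a random quadratic form over a field
with `q⁻¹` elements, when one variable is added. -/
def radStep (q : ℝ) : Module.End ℝ (ℕ → ℝ) where
  toFun u r := (1 - q ^ r) * u (r - 1) + q ^ (r + 1) * u (r + 1) + q ^ r * (1 - q) * u r
  map_add' u v := by ext s; simp only [Pi.add_apply]; ring
  map_smul' c u := by ext s; simp only [Pi.smul_apply, smul_eq_mul, RingHom.id_apply]; ring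

/-- A shift operator that commutes with `altStep x` up to the factor `x`. -/
def altShift (x : ℝ) : Module.End ℝ (ℕ → ℝ) where
  toFun u s := x ^ s * (x * u (s + 2) - u s)
  map_add' u v := by ext s; simp only [Pi.add_apply]; ring
  map_smul' c u := by ext s; simp only [Pi.smul_apply, smul_eq_mul, RingHom.id_apply]; ring

/-- A shift operator that commutes with `radStep q` up to the factor `q`. -/
def radShift (q : ℝ) : Module.End ℝ (ℕ → ℝ) where
  toFun u r := q ^ r * (q * u (r + 2) + (1 - q) * u (r + 1) - u r)
  map_add' u v := by ext s; simp only [Pi.add_apply]; ring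
  map_smul' c u := by ext s; simp only [Pi.smul_apply, smul_eq_mul, RingHom.id_apply]; ring

theorem altStep_apply (x : ℝ) (u : ℕ → ℝ) (s : ℕ) :
    altStep x u s = (1 - x ^ s) * u (s - 1) + x ^ (s + 1) * u (s + 1) := rfl

theorem radStep_apply (q : ℝ) (u : ℕ → ℝ) (r : ℕ) :
    radStep q u r =
      (1 - q ^ r) * u (r - 1) + q ^ (r + 1) * u (r + 1) + q ^ r * (1 - q) * u r := rfl

theorem altShift_apply (x : ℝ) (u : ℕ → ℝ) (s : ℕ) :
    altShift x u s = x ^ s * (x * u (s + 2) - u s) := rfl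

theorem radShift_apply (q : ℝ) (u : ℕ → ℝ) (r : ℕ) :
    radShift q u r = q ^ r * (q * u (r + 2) + (1 - q) * u (r + 1) - u r) := rfl

theorem altShift_mul_altStep (x : ℝ) : altShift x * altStep x = x • (altStep x * altShift x) := by
  ext u s
  rcases s with _ | s
  · simp only [Module.End.mul_apply, LinearMap.smul_apply, Pi.smul_apply, smul_eq_mul,
      altStep_apply, altShift_apply]
    simp
    ring
  · simp only [Module.End.mul_apply, LinearMap.smul_apply, Pi.smul_apply, smul_eq_mul,
      altStep_apply, altShift_apply, Nat.add_sub_cancel, show s + 1 + 2 - 1 = s + 2 by omega]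
    ring_nf

theorem radShift_mul_radStep (q : ℝ) : radShift q * radStep q = q • (radStep q * radShift q) := by
  ext u s
  rcases s with _ | s
  · simp only [Module.End.mul_apply, LinearMap.smul_apply, Pi.smul_apply, smul_eq_mul,
      radStep_apply, radShift_apply]
    simp
    ring
  · simp only [Module.End.mul_apply, LinearMap.smul_apply, Pi.smul_apply, smul_eq_mul,
      radStep_apply, radShift_apply, Nat.add_sub_cancel, show s + 1 + 2 - 1 = s + 2 by omega]
    ring_nf

theorem mul_pow_of_mul_eq_smul {A : Type*} [Ring A] [Algebra ℝ A] {a b : A} {x : ℝ}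
    (h : a * b = x • (b * a)) (t : ℕ) : a * b ^ t = x ^ t • (b ^ t * a) := by
  induction t with
  | zero => simp
  | succ t ih =>
    rw [pow_succ, ← mul_assoc, ih, smul_mul_assoc, mul_assoc, h, mul_smul_comm, smul_smul,
      ← pow_succ, mul_assoc]

/-- The case `t = 0` is a direct computation at `s = 0`, where the coefficient `1 - x ^ s` vanishes.
Apply it to the `t`-th iterate and move the shift through `altStep x ^ t` at the cost of `x ^ t`. -/
theorem altStep_pow_recurrence (x : ℝ) (u : ℕ → ℝ) (t : ℕ) :
    ((altStep x) ^ (t + 2)) u 0 - x * ((altStep x) ^ t) u 0 =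
      x ^ (t + 2) * ((altStep x) ^ t) (altShift x u) 0 := by
  have h : ∀ v : ℕ → ℝ, altStep x (altStep x v) 0 - x * v 0 = x ^ 2 * altShift x v 0 := by
    intro v
    simp only [altStep_apply, altShift_apply]
    simp
    ring
  have h2 := congrArg (fun g : Module.End ℝ (ℕ → ℝ) => g u 0)
    (mul_pow_of_mul_eq_smul (altShift_mul_altStep x) t)
  simp only [Module.End.mul_apply, LinearMap.smul_apply, Pi.smul_apply, smul_eq_mul] at h2
  rw [pow_succ', pow_succ', Module.End.mul_apply, Module.End.mul_apply, h, h2]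
  ring

theorem radStep_pow_recurrence (q : ℝ) (u : ℕ → ℝ) (t : ℕ) :
    ((radStep q) ^ (t + 2)) u 0 - (1 - q) * ((radStep q) ^ (t + 1)) u 0 -
        q * ((radStep q) ^ t) u 0 = q ^ (t + 2) * ((radStep q) ^ t) (radShift q u) 0 := by
  have h : ∀ v : ℕ → ℝ, radStep q (radStep q v) 0 - (1 - q) * radStep q v 0 - q * v 0 =
      q ^ 2 * radShift q v 0 := by
    intro v
    simp only [radStep_apply, radShift_apply]
    simp
    ring
  have h2 := congrArg (fun g : Module.End ℝ (ℕ → ℝ) => g u 0)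
    (mul_pow_of_mul_eq_smul (radShift_mul_radStep q) t)
  simp only [Module.End.mul_apply, LinearMap.smul_apply, Pi.smul_apply, smul_eq_mul] at h2
  rw [pow_succ', pow_succ', Module.End.mul_apply, Module.End.mul_apply, h, h2]
  ring

/-- The operator links `s` only to `s - 1` and `s + 1`, so the two parity classes decouple; later
identities are needed on one class only. -/
theorem altStep_pow_congr (x : ℝ) {u v : ℕ → ℝ} (a t : ℕ)
    (h : ∀ s, s % 2 = (a + t) % 2 → u s = v s) :
    ∀ s, s % 2 = a % 2 → ((altStep x) ^ t) u s = ((altStep x) ^ t) v s := by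
  induction t generalizing u v with
  | zero => simpa using h
  | succ t ih =>
    rw [pow_succ, Module.End.mul_apply, Module.End.mul_apply]
    refine ih fun s hs => ?_
    rw [altStep_apply, altStep_apply, h (s + 1) (by omega)]
    rcases s with _ | s
    · simp
    · rw [Nat.add_sub_cancel, h s (by omega)]

/-! ### Iterates on the product that occurs in φ -/

/-- `∏_{r=1}^d (x^{2r-1} - 1) / (x^{2r} - 1)`. -/
noncomputable def oddEvenProd (x : ℝ) (d : ℕ) : ℝ :=
  ∏ r ∈ Finset.Icc 1 d, (x ^ (2 * r - 1) - 1) / (x ^ (2 * r) - 1)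

theorem pow_sub_one_ne_zero {x : ℝ} (hx : 0 < x) (hx1 : x ≠ 1) {n : ℕ} (hn : n ≠ 0) :
    x ^ n - 1 ≠ 0 :=
  sub_ne_zero.2 fun h => hx1 ((pow_eq_one_iff_of_nonneg hx.le hn).1 h)

theorem oddEvenProd_succ (x : ℝ) (d : ℕ) :
    oddEvenProd x (d + 1) = oddEvenProd x d * ((x ^ (2 * d + 1) - 1) / (x ^ (2 * d + 2) - 1)) := by
  rw [oddEvenProd, Finset.prod_Icc_succ_top (by omega), oddEvenProd]
  rfl

theorem oddEvenProd_inv {x : ℝ} (hx : 0 < x) (hx1 : x ≠ 1) (d : ℕ) :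
    oddEvenProd x⁻¹ d = x ^ d * oddEvenProd x d := by
  induction d with
  | zero => simp [oddEvenProd]
  | succ d ih =>
    have h2 : x ^ (2 * d + 2) - 1 ≠ 0 := pow_sub_one_ne_zero hx hx1 (by omega)
    have h3 : 1 - x ^ (2 * d + 2) ≠ 0 := by rwa [← neg_ne_zero, neg_sub]
    have h4 : x ^ (2 * d + 1) ≠ 0 := by positivity
    have : ((x⁻¹) ^ (2 * d + 1) - 1) / ((x⁻¹) ^ (2 * d + 2) - 1) =
        x * ((x ^ (2 * d + 1) - 1) / (x ^ (2 * d + 2) - 1)) := by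
      have e1 : (x⁻¹) ^ (2 * d + 1) - 1 = (1 - x ^ (2 * d + 1)) / x ^ (2 * d + 1) := by
        rw [inv_pow]; field_simp
      have e2 : (x⁻¹) ^ (2 * d + 2) - 1 = (1 - x ^ (2 * d + 2)) / x ^ (2 * d + 2) := by
        rw [inv_pow]; field_simp
      rw [e1, e2, div_div_div_eq, div_eq_iff (by positivity), mul_div_assoc', div_mul_eq_mul_div,
        eq_div_iff h2]
      ring
    rw [oddEvenProd_succ, oddEvenProd_succ, ih, this]
    ring

/-- The function `s ↦ oddEvenProd x ⌈s / 2⌉`. -/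
noncomputable def ceilProd (x : ℝ) (s : ℕ) : ℝ := oddEvenProd x ((s + 1) / 2)

theorem ceilProd_even (x : ℝ) (d : ℕ) : ceilProd x (2 * d) = oddEvenProd x d := by
  rw [ceilProd]; congr 1; omega

theorem ceilProd_odd (x : ℝ) (d : ℕ) : ceilProd x (2 * d + 1) = oddEvenProd x (d + 1) := by
  rw [ceilProd]; congr 1; omega

theorem altStep_ceilProd_odd {x : ℝ} (hx : 0 < x) (hx1 : x ≠ 1) (d : ℕ) :
    altStep x (ceilProd x) (2 * d + 1) = ceilProd x (2 * d + 1) := by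
  have h2 : x ^ (2 * d + 2) - 1 ≠ 0 := pow_sub_one_ne_zero hx hx1 (by omega)
  rw [altStep_apply, Nat.add_sub_cancel, show 2 * d + 1 + 1 = 2 * (d + 1) by ring, ceilProd_even,
    ceilProd_even, ceilProd_odd, oddEvenProd_succ]
  rw [show 2 * (d + 1) = 2 * d + 2 by ring]
  field_simp
  ring

theorem altStep_sq_even (x : ℝ) (u : ℕ → ℝ) (d : ℕ) :
    altStep x (altStep x u) (2 * d) = (1 - x ^ (2 * d)) * (altStep x u (2 * d - 1)) +
      x ^ (2 * d + 1) * ((1 - x ^ (2 * d + 1)) * u (2 * d) + x ^ (2 * d + 2) * u (2 * (d + 1))) := by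
  rw [altStep_apply, altStep_apply x u (2 * d + 1)]
  rfl

theorem altStep_sq_ceilProd_even {x : ℝ} (hx : 0 < x) (hx1 : x ≠ 1) (d : ℕ) :
    altStep x (altStep x (ceilProd x)) (2 * d) - ceilProd x (2 * d) =
      altShift x (ceilProd x) (2 * d) := by
  -- For `d = 0` the truncated index `2 * d - 1` is harmless, because its coefficient is zero.
  have h1 : (1 - x ^ (2 * d)) * altStep x (ceilProd x) (2 * d - 1) =
      (1 - x ^ (2 * d)) * oddEvenProd x d := by
    rcases d with _ | d
    · simp
    · rw [show 2 * (d + 1) - 1 = 2 * d + 1 by omega, altStep_ceilProd_odd hx hx1, ceilProd_odd]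
  have h2 : x ^ (2 * d + 2) - 1 ≠ 0 := pow_sub_one_ne_zero hx hx1 (by omega)
  rw [altStep_sq_even, h1, altShift_apply, show 2 * d + 2 = 2 * (d + 1) by ring, ceilProd_even,
    ceilProd_even, oddEvenProd_succ, show 2 * (d + 1) = 2 * d + 2 by ring]
  field_simp
  ring

/-- On even arguments the shift of `ceilProd x` is `altStep x ^ 2 - 1` applied to it. The recurrence
becomes `(1 - x ^ (2d+2)) * T (d+1) = x * (1 - x ^ (2d+1)) * T d` for the values `T d` at `0`, which
is the recursion of the product. -/
theorem altStep_pow_ceilProd_even {x : ℝ} (hx : 0 < x) (hx1 : x ≠ 1) (d : ℕ) :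
    ((altStep x) ^ (2 * d)) (ceilProd x) 0 = x ^ d * oddEvenProd x d := by
  induction d with
  | zero => simp [ceilProd]
  | succ d ih =>
    have h := altStep_pow_recurrence x (ceilProd x) (2 * d)
    have h3 := altStep_pow_congr x (u := altShift x (ceilProd x))
      (v := altStep x (altStep x (ceilProd x)) - ceilProd x) 0 (2 * d) (fun s hs => by
        obtain ⟨k, rfl⟩ : ∃ k, s = 2 * k := ⟨s / 2, by omega⟩
        rw [Pi.sub_apply, altStep_sq_ceilProd_even hx hx1]) 0 rfl
    have h2 : x ^ (2 * d + 2) - 1 ≠ 0 := pow_sub_one_ne_zero hx hx1 (by omega)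
    rw [h3, map_sub, Pi.sub_apply, ← Module.End.mul_apply, ← Module.End.mul_apply, ← pow_succ,
      ← pow_succ, ih] at h
    rw [show 2 * (d + 1) = 2 * d + 2 by ring, oddEvenProd_succ]
    rw [show 2 * d + 1 + 1 = 2 * d + 2 by ring] at h
    rw [mul_div_assoc', mul_div_assoc', eq_div_iff h2]
    linear_combination -h

theorem altStep_pow_ceilProd {x : ℝ} (hx : 0 < x) (hx1 : x ≠ 1) (t : ℕ) :
    ((altStep x) ^ t) (ceilProd x) 0 = x ^ ((t + 1) / 2) * oddEvenProd x ((t + 1) / 2) := by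
  obtain ⟨d, rfl | rfl⟩ : ∃ d, t = 2 * d ∨ t = 2 * d + 1 := ⟨t / 2, by omega⟩
  · rw [altStep_pow_ceilProd_even hx hx1, show (2 * d + 1) / 2 = d by omega]
  -- On odd arguments `ceilProd x` is fixed by `altStep x`, so an odd number of steps gives the same
  -- value as one step more.
  · rw [show (2 * d + 1 + 1) / 2 = d + 1 by omega, ← altStep_pow_ceilProd_even hx hx1,
      show 2 * (d + 1) = 2 * d + 1 + 1 by ring, pow_succ _ (2 * d + 1), Module.End.mul_apply]
    refine altStep_pow_congr x 0 _ (fun s hs => ?_) 0 rfl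
    obtain ⟨k, rfl⟩ : ∃ k, s = 2 * k + 1 := ⟨s / 2, by omega⟩
    exact (altStep_ceilProd_odd hx hx1 k).symm

theorem radStep_ceilProd {p : ℝ} (hx : 0 < p) (hx1 : p ≠ 1) (r : ℕ) :
    radStep p⁻¹ (ceilProd p) r = p * ceilProd p (r + 1) := by
  obtain ⟨d, rfl | rfl⟩ : ∃ d, r = 2 * d ∨ r = 2 * d + 1 := ⟨r / 2, by omega⟩
  · have h1 : (1 - p⁻¹ ^ (2 * d)) * ceilProd p (2 * d - 1) =
        (1 - p⁻¹ ^ (2 * d)) * oddEvenProd p d := by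
      rcases d with _ | d
      · simp
      · rw [show 2 * (d + 1) - 1 = 2 * d + 1 by omega, ceilProd_odd]
    have h2 : p ^ (2 * d + 2) - 1 ≠ 0 := pow_sub_one_ne_zero hx hx1 (by omega)
    rw [radStep_apply, h1, ceilProd_odd, ceilProd_even, oddEvenProd_succ]
    simp only [inv_pow]
    field_simp
    ring
  · have h2 : p ^ (2 * d + 2) - 1 ≠ 0 := pow_sub_one_ne_zero hx hx1 (by omega)
    have h3 : p ^ (2 * d + 1) - 1 ≠ 0 := pow_sub_one_ne_zero hx hx1 (by omega)
    rw [radStep_apply, Nat.add_sub_cancel, show 2 * d + 1 + 1 = 2 * (d + 1) by ring, ceilProd_even,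
      ceilProd_even, ceilProd_odd, oddEvenProd_succ, show 2 * (d + 1) = 2 * d + 2 by ring]
    simp only [inv_pow]
    field_simp
    ring

/-- This is the case `s = 0` read at `r + s` and multiplied by `p ^ s`, which turns `p⁻¹ ^ (r + s)`
into `p⁻¹ ^ r`. The coefficients on the right are those of `altStep p` in the variable `s`, so
`radStep p⁻¹` in `r` can be traded for `altStep p` in `s`. -/
theorem radStep_ceilProd_shift {p : ℝ} (hx : 0 < p) (hx1 : p ≠ 1) (s : ℕ) :
    radStep p⁻¹ (fun r => ceilProd p (r + s)) =
      (1 - p ^ s) • (fun r => ceilProd p (r + (s - 1))) +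
        p ^ (s + 1) • (fun r => ceilProd p (r + (s + 1))) := by
  ext r
  have h := radStep_ceilProd hx hx1 (r + s)
  rw [radStep_apply] at h
  simp only [radStep_apply, Pi.add_apply, Pi.smul_apply, smul_eq_mul]
  have hp : p ≠ 0 := hx.ne'
  rcases s with _ | s
  · simpa [hp] using h
  · have e : (1 - p⁻¹ ^ r) * ceilProd p (r - 1 + (s + 1)) = (1 - p⁻¹ ^ r) * ceilProd p (r + s) := by
      rcases r with _ | r
      · simp
      · congr 2; omega
    rw [show r + (s + 1) - 1 = r + s by omega] at h
    rw [e, Nat.add_sub_cancel, show r + 1 + (s + 1) = r + (s + 1) + 1 by ring,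
      show r + (s + 1 + 1) = r + (s + 1) + 1 by ring]
    have e1 : p ^ (s + 1) * p⁻¹ ^ (r + (s + 1)) = p⁻¹ ^ r := by
      rw [pow_add p⁻¹, mul_left_comm, ← mul_pow, mul_inv_cancel₀ hp, one_pow, mul_one]
    have e2 : p ^ (s + 1) * p⁻¹ ^ (r + (s + 1) + 1) = p⁻¹ ^ (r + 1) := by
      rw [pow_succ p⁻¹, ← mul_assoc, e1, pow_succ]
    linear_combination p ^ (s + 1) * h + ceilProd p (r + s) * e1 -
      ceilProd p (r + (s + 1) + 1) * e2 - (1 - p⁻¹) * ceilProd p (r + (s + 1)) * e1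

theorem radStep_pow_ceilProd_shift {p : ℝ} (hx : 0 < p) (hx1 : p ≠ 1) (t s : ℕ) :
    ((radStep p⁻¹) ^ t) (fun r => ceilProd p (r + s)) 0 = ((altStep p) ^ t) (ceilProd p) s := by
  induction t generalizing s with
  | zero => simp
  | succ t ih =>
    rw [pow_succ, Module.End.mul_apply, radStep_ceilProd_shift hx hx1, map_add, map_smul, map_smul,
      Pi.add_apply, Pi.smul_apply, Pi.smul_apply, ih, ih, pow_succ' (altStep p), Module.End.mul_apply,
      altStep_apply, smul_eq_mul, smul_eq_mul]

theorem radStep_pow_ceilProd {p : ℝ} (hx : 0 < p) (hx1 : p ≠ 1) (t : ℕ) :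
    ((radStep p⁻¹) ^ t) (ceilProd p) 0 = p ^ ((t + 1) / 2) * oddEvenProd p ((t + 1) / 2) := by
  rw [← altStep_pow_ceilProd hx hx1 t, ← radStep_pow_ceilProd_shift hx hx1]
  rfl

/-- By `oddEvenProd_inv` the starting function is `ceilProd p⁻¹`, and the powers of `p` cancel in
its iterate. -/
theorem altStep_pow_ceilProd_inv {p : ℝ} (hx : 0 < p) (hx1 : p ≠ 1) (t : ℕ) :
    ((altStep p⁻¹) ^ t) (fun r => p ^ ((r + 1) / 2) * oddEvenProd p ((r + 1) / 2)) 0 =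
      oddEvenProd p ((t + 1) / 2) := by
  have h := altStep_pow_ceilProd (inv_pos.2 hx) (by simpa using hx1) t
  rw [oddEvenProd_inv hx hx1, ← mul_assoc, ← mul_pow, inv_mul_cancel₀ hx.ne', one_pow, one_mul] at h
  rw [← h]
  refine congrArg (fun g => ((altStep p⁻¹) ^ t) g 0) (funext fun r => ?_)
  rw [ceilProd, oddEvenProd_inv hx hx1]

/-! ### Iterates on the rational functions that occur in ψ -/

/-- The function `s ↦ x^{⌊s/2⌋ + 1} / (1 - x^{s+1})`. -/
noncomputable def halfGeom (x : ℝ) (s : ℕ) : ℝ := x ^ (s / 2 + 1) / (1 - x ^ (s + 1))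

theorem one_sub_pow_ne_zero {x : ℝ} (hx : 0 < x) (hx1 : x ≠ 1) {n : ℕ} (hn : n ≠ 0) :
    1 - x ^ n ≠ 0 :=
  sub_ne_zero.2 fun h => hx1 ((pow_eq_one_iff_of_nonneg hx.le hn).1 h.symm)

theorem halfGeom_even (x : ℝ) (d : ℕ) :
    halfGeom x (2 * d) = x ^ (d + 1) / (1 - x ^ (2 * d + 1)) := by
  rw [halfGeom, Nat.mul_div_cancel_left _ two_pos]

theorem altStep_sq_halfGeom_even {x : ℝ} (hx : 0 < x) (hx1 : x ≠ 1) (d : ℕ) :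
    x * altStep x (altStep x (halfGeom x)) (2 * d) - halfGeom x (2 * d) =
      altShift x (halfGeom x) (2 * d) := by
  have n1 : 1 - x ^ (2 * d + 1) ≠ 0 := one_sub_pow_ne_zero hx hx1 (by omega)
  have n3 : 1 - x ^ (2 * d + 3) ≠ 0 := one_sub_pow_ne_zero hx hx1 (by omega)
  rw [altStep_sq_even, altShift_apply, show 2 * d + 2 = 2 * (d + 1) by ring, halfGeom_even,
    halfGeom_even]
  rcases d with _ | d
  · simp only [Nat.mul_zero, pow_zero, sub_self, zero_mul, zero_add, mul_one] at *
    field_simp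
    ring
  · have n0 : 1 - x ^ (2 * d + 1) ≠ 0 := one_sub_pow_ne_zero hx hx1 (by omega)
    rw [show 2 * (d + 1) - 1 = 2 * d + 1 by omega, altStep_apply, Nat.add_sub_cancel,
      show 2 * d + 1 + 1 = 2 * (d + 1) by ring, halfGeom_even, halfGeom_even]
    simp only [Nat.mul_add, mul_one] at *
    field_simp
    ring

/-- Here the shift equals `x * altStep x ^ 2 - 1` on even arguments, so the values `T d` at `0`
satisfy `(1 - x ^ (2d+3)) * T (d+1) = x * (1 - x ^ (2d+1)) * T d`. -/
theorem altStep_pow_halfGeom {x : ℝ} (hx : 0 < x) (hx1 : x ≠ 1) (d : ℕ) :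
    ((altStep x) ^ (2 * d)) (halfGeom x) 0 = halfGeom x (2 * d) := by
  induction d with
  | zero => simp
  | succ d ih =>
    have h := altStep_pow_recurrence x (halfGeom x) (2 * d)
    have h3 := altStep_pow_congr x (u := altShift x (halfGeom x))
      (v := x • altStep x (altStep x (halfGeom x)) - halfGeom x) 0 (2 * d) (fun s hs => by
        obtain ⟨k, rfl⟩ : ∃ k, s = 2 * k := ⟨s / 2, by omega⟩
        rw [Pi.sub_apply, Pi.smul_apply, smul_eq_mul, altStep_sq_halfGeom_even hx hx1]) 0 rfl
    have n1 : 1 - x ^ (2 * d + 1) ≠ 0 := one_sub_pow_ne_zero hx hx1 (by omega)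
    have n3 : 1 - x ^ (2 * d + 3) ≠ 0 := one_sub_pow_ne_zero hx hx1 (by omega)
    rw [h3, map_sub, Pi.sub_apply, map_smul, Pi.smul_apply, ← Module.End.mul_apply,
      ← Module.End.mul_apply, ← pow_succ, ← pow_succ, ih, halfGeom_even, smul_eq_mul] at h
    rw [halfGeom_even, show 2 * (d + 1) = 2 * d + 2 by ring]
    rw [show 2 * d + 1 + 1 = 2 * d + 2 by ring] at h
    rw [eq_div_iff n3]
    field_simp at h
    apply mul_right_cancel₀ n1
    linear_combination h

/-- The function with value `-q^{r+1} / (1 - q^{r+1})` at even `r` and `1` at odd `r`. -/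
noncomputable def parityGeom (q : ℝ) (r : ℕ) : ℝ :=
  if Even r then -(q * q ^ r) / (1 - q * q ^ r) else 1

section ParityGeom

variable {q : ℝ}

theorem one_sub_mul_pow_ne_zero (hq : 0 < q) (hq1 : q < 1) (a r : ℕ) :
    1 - q ^ (a + 1) * q ^ r ≠ 0 := by
  rw [← pow_add]
  exact one_sub_pow_ne_zero hq hq1.ne (by omega)

theorem radStep_parityGeom (hq : 0 < q) (hq1 : q < 1) (r : ℕ) :
    radStep q (parityGeom q) r =
      if Even r then (1 - q ^ r) / (1 - q * q ^ r) else -(q * q ^ r) / (1 - q ^ 2 * q ^ r) := by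
  rw [radStep_apply]
  rcases r with _ | s
  · have := one_sub_mul_pow_ne_zero hq hq1 0 0
    simp [parityGeom] at this ⊢
    field_simp
    ring
  · have n1 := one_sub_mul_pow_ne_zero hq hq1 0 s
    have n2 := one_sub_mul_pow_ne_zero hq hq1 1 s
    have n3 := one_sub_mul_pow_ne_zero hq hq1 2 s
    rw [Nat.add_sub_cancel]
    by_cases hs : Even s
    · simp only [parityGeom, hs, Nat.even_add_one, not_true, not_false_iff, if_true, if_false,
        pow_succ' q s, pow_succ' q (s + 1), zero_add, pow_one] at *
      generalize q ^ s = Y at *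
      have n3' : 1 - q * (q * (q * Y)) ≠ 0 := by convert n3 using 1; ring
      have n3'' : 1 - q ^ 2 * (q * Y) ≠ 0 := by convert n3 using 1; ring
      field_simp
      ring
    · simp only [parityGeom, hs, Nat.even_add_one, not_true, not_false_iff, if_true, if_false,
        pow_succ' q s, pow_succ' q (s + 1), zero_add, pow_one] at *
      generalize q ^ s = Y at *
      have n2' : 1 - q * (q * Y) ≠ 0 := by convert n2 using 1; ring
      field_simp
      ring

/-- The value of `radStep q ^ 2` on `parityGeom q`. -/
noncomputable def parityGeomStepTwo (q : ℝ) (r : ℕ) : ℝ :=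
  if Even r then
    -(q * q ^ r * (1 - q ^ r)) / (1 - q * q ^ r) - q ^ 3 * (q ^ r) ^ 2 / (1 - q ^ 3 * q ^ r)
  else 1 - q ^ r / q +
    (q * q ^ r * (1 - q * q ^ r) - q * (1 - q) * (q ^ r) ^ 2) / (1 - q ^ 2 * q ^ r)

theorem radStep_radStep_parityGeom (hq : 0 < q) (hq1 : q < 1) (r : ℕ) :
    radStep q (radStep q (parityGeom q)) r = parityGeomStepTwo q r := by
  rw [radStep_apply, parityGeomStepTwo]
  simp only [radStep_parityGeom hq hq1]
  rcases r with _ | s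
  · have n1 := one_sub_mul_pow_ne_zero hq hq1 0 0
    have n3 := one_sub_mul_pow_ne_zero hq hq1 2 0
    simp at n1 n3 ⊢
    field_simp
  · have n1 := one_sub_mul_pow_ne_zero hq hq1 0 s
    have n2 := one_sub_mul_pow_ne_zero hq hq1 1 s
    have n3 := one_sub_mul_pow_ne_zero hq hq1 2 s
    have n4 := one_sub_mul_pow_ne_zero hq hq1 3 s
    rw [Nat.add_sub_cancel]
    by_cases hs : Even s
    · simp only [hs, Nat.even_add_one, not_true, not_false_iff, if_true, if_false,
        pow_succ' q s, pow_succ' q (s + 1), zero_add, pow_one] at *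
      generalize q ^ s = Y at *
      have n3' : 1 - q * (q * (q * Y)) ≠ 0 := by convert n3 using 1; ring
      have n3'' : 1 - q ^ 2 * (q * Y) ≠ 0 := by convert n3 using 1; ring
      field_simp
      ring
    · simp only [hs, Nat.even_add_one, not_true, not_false_iff, if_true, if_false,
        pow_succ' q s, pow_succ' q (s + 1), zero_add, pow_one] at *
      generalize q ^ s = Y at *
      have n2' : 1 - q * (q * Y) ≠ 0 := by convert n2 using 1; ring
      have n4' : 1 - q ^ 3 * (q * Y) ≠ 0 := by convert n4 using 1; ring
      have n4'' : 1 - q ^ 2 * (q * (q * Y)) ≠ 0 := by convert n4 using 1; ring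
      field_simp
      ring

/-- Rewriting the value at `r - 1` in terms of `q ^ r` lets `radShift_parityGeom` be checked by
parity alone, without a separate case `r = 0`. -/
theorem one_sub_mul_parityGeomStepTwo (hq : 0 < q) (hq1 : q < 1) (r : ℕ) :
    (1 - q ^ r) * parityGeomStepTwo q (r - 1) =
      if Even r then (1 - q ^ r) * (1 - q ^ r / q ^ 2 +
        (q ^ r * (1 - q ^ r) - (1 - q) * (q ^ r) ^ 2 / q) / (1 - q * q ^ r))
      else -(q ^ r * (1 - q ^ r / q)) -
        (1 - q ^ r) * (q * (q ^ r) ^ 2) / (1 - q ^ 2 * q ^ r) := by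
  rcases r with _ | s
  · simp
  · have n1 := one_sub_mul_pow_ne_zero hq hq1 0 s
    have n2 := one_sub_mul_pow_ne_zero hq hq1 1 s
    have n3 := one_sub_mul_pow_ne_zero hq hq1 2 s
    rw [Nat.add_sub_cancel]
    by_cases hs : Even s
    · simp only [parityGeomStepTwo, hs, Nat.even_add_one, not_true, if_true, if_false,
        pow_succ' q s, zero_add, pow_one] at *
      generalize q ^ s = Y at *
      have n3' : 1 - q ^ 2 * (q * Y) ≠ 0 := by convert n3 using 1; ring
      field_simp
    · simp only [parityGeomStepTwo, hs, Nat.even_add_one, not_false_iff, if_true, if_false,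
        pow_succ' q s, zero_add, pow_one] at *
      generalize q ^ s = Y at *
      have n2' : 1 - q * (q * Y) ≠ 0 := by convert n2 using 1; ring
      field_simp

theorem radShift_parityGeom (hq : 0 < q) (hq1 : q < 1) :
    q • (q • radStep q (radStep q (radStep q (parityGeom q)) - parityGeom q) -
        (radStep q (radStep q (parityGeom q)) - parityGeom q)) =
      radShift q (radStep q (parityGeom q) - q • parityGeom q) := by
  ext r
  simp only [Pi.sub_apply, Pi.smul_apply, smul_eq_mul, map_sub, radShift_apply]
  rw [radStep_apply q (radStep q (radStep q (parityGeom q)))]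
  simp only [radStep_radStep_parityGeom hq hq1, radStep_parityGeom hq hq1,
    one_sub_mul_parityGeomStepTwo hq hq1]
  have n1 := one_sub_mul_pow_ne_zero hq hq1 0 r
  have n2 := one_sub_mul_pow_ne_zero hq hq1 1 r
  have n3 := one_sub_mul_pow_ne_zero hq hq1 2 r
  have n4 := one_sub_mul_pow_ne_zero hq hq1 3 r
  have e1 (X : ℝ) : q * (q * X) = q ^ 2 * X := by ring
  have e2 (X : ℝ) : q ^ 2 * (q * X) = q ^ 3 * X := by ring
  have e3 (X : ℝ) : q ^ 3 * (q * X) = q ^ 4 * X := by ring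
  have e4 (X : ℝ) : q * (q ^ 2 * X) = q ^ 3 * X := by ring
  have e5 (X : ℝ) : q ^ 2 * (q ^ 2 * X) = q ^ 4 * X := by ring
  by_cases hs : Even r
  · simp only [parityGeomStepTwo, parityGeom, hs, Nat.even_add_one, not_true, not_false_iff,
      if_true, if_false, pow_succ' q r, pow_succ' q (r + 1),
      zero_add, pow_one, e1, e2, e3, e4, e5] at *
    generalize q ^ r = Y at *
    field_simp
    ring
  · simp only [parityGeomStepTwo, parityGeom, hs, Nat.even_add_one, not_true, not_false_iff,
      if_true, if_false, pow_succ' q r, pow_succ' q (r + 1),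
      zero_add, pow_one, e1, e2, e3, e4, e5] at *
    generalize q ^ r = Y at *
    field_simp
    ring

theorem radStep_pow_parityGeom (hq : 0 < q) (hq1 : q < 1) (t : ℕ) :
    ((radStep q) ^ t) (parityGeom q) 0 =
      if Even t then -(q * q ^ t) / (1 - q * q ^ t) else 0 := by
  -- The difference of two consecutive instances of this relation is `radStep_pow_recurrence` for
  -- `radStep q g - q • g`, `g = parityGeom q`, with its shift rewritten by `radShift_parityGeom`.
  -- The relation steps `t` by two, so the values at `t = 0` and `t = 1` determine all others.
  have key (t : ℕ) : ((radStep q) ^ (t + 2)) (parityGeom q) 0 -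
      q ^ 2 * ((radStep q) ^ t) (parityGeom q) 0 =
      q ^ (t + 3) * (((radStep q) ^ (t + 2)) (parityGeom q) 0 -
        ((radStep q) ^ t) (parityGeom q) 0) := by
    induction t with
    | zero =>
      have h1 := one_sub_mul_pow_ne_zero hq hq1 0 0
      have h3 := one_sub_mul_pow_ne_zero hq hq1 2 0
      rw [zero_add, pow_two, Module.End.mul_apply, radStep_radStep_parityGeom hq hq1]
      simp [parityGeomStepTwo, parityGeom] at h1 h3 ⊢
      field_simp
      ring
    | succ t ih =>
      have h := radStep_pow_recurrence q (radStep q (parityGeom q) - q • parityGeom q) t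
      rw [← radShift_parityGeom hq hq1] at h
      simp only [map_sub, map_smul, ← Module.End.mul_apply, ← pow_succ, ← mul_assoc,
        Pi.sub_apply, Pi.smul_apply, smul_eq_mul] at h
      linear_combination h + ih
  induction t using Nat.twoStepInduction with
  | zero => simp [parityGeom]
  | one => simp [radStep_parityGeom hq hq1]
  | more t ih _ =>
    have h := key t
    have h1 := one_sub_mul_pow_ne_zero hq hq1 0 t
    have h3 := one_sub_mul_pow_ne_zero hq hq1 2 t
    rw [ih] at h
    by_cases ht : Even t
    · simp only [ht, if_true, Nat.even_add, even_two] at h ⊢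
      have h3' : 1 - q * q ^ (t + 2) ≠ 0 := by convert h3 using 1; ring
      simp only [zero_add, pow_one] at h1
      rw [eq_div_iff h3']
      field_simp at h
      apply mul_right_cancel₀ h1
      linear_combination h
    · simp only [ht, if_false, Nat.even_add, even_two, iff_true] at h ⊢
      have h3' : 1 - q ^ (t + 3) ≠ 0 := by convert h3 using 1; ring
      apply mul_right_cancel₀ h3'
      linear_combination h

end ParityGeom

/-! ### Types of quadratic forms and their uniqueness -/

open Matrix in
/-- A function on a vector space is, in suitable coordinates, the sum of a zero form in `r`
variables, of `l` hyperbolic planes and of an anisotropic quadratic form in `m` variables. -/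
def HasType {F V : Type*} [Field F] [AddCommGroup V] [Module F V] (g : V → F) (l m r : ℕ) : Prop :=
  ∃ (f : QuadraticForm F (Fin m → F))
    (e : V ≃ₗ[F] (Fin r → F) × (Fin l → F) × (Fin l → F) × (Fin m → F)),
    f.Anisotropic ∧ ∀ v, g v = (e v).2.1 ⬝ᵥ (e v).2.2.1 + f (e v).2.2.2

section HasType

open Matrix

variable {F V V' : Type*} [Field F] [AddCommGroup V] [Module F V] [AddCommGroup V'] [Module F V']

theorem HasType.comp_equiv {g : V → F} {l m r : ℕ} (h : HasType g l m r) (e : V' ≃ₗ[F] V)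
    {g' : V' → F} (hg : ∀ v, g' v = g (e v)) : HasType g' l m r := by
  obtain ⟨f, e', hf, h⟩ := h
  exact ⟨f, e ≪≫ₗ e', hf, fun v => by rw [hg, h]; rfl⟩

/-- Concatenation of tuples as a linear equivalence. -/
def appendLinearEquiv (F : Type*) [Field F] (a b : ℕ) :
    ((Fin a → F) × (Fin b → F)) ≃ₗ[F] (Fin (a + b) → F) :=
  (LinearEquiv.sumArrowLequivProdArrow (Fin a) (Fin b) F F).symm ≪≫ₗ
    LinearEquiv.funCongrLeft F F finSumFinEquiv.symm

theorem appendLinearEquiv_dotProduct (a b : ℕ) (x y : (Fin a → F) × (Fin b → F)) :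
    appendLinearEquiv F a b x ⬝ᵥ appendLinearEquiv F a b y = x.1 ⬝ᵥ y.1 + x.2 ⬝ᵥ y.2 := by
  simp [dotProduct, Fin.sum_univ_add, appendLinearEquiv, LinearEquiv.funCongrLeft_apply,
    LinearMap.funLeft_apply]
  rfl

theorem HasType.sum {g : V → F} {l m r : ℕ} (h : HasType g l m r) (l' r' : ℕ)
    (e : V' ≃ₗ[F] (Fin r' → F) × (Fin l' → F) × (Fin l' → F) × V)
    {g' : V' → F} (hg : ∀ v, g' v = (e v).2.1 ⬝ᵥ (e v).2.2.1 + g (e v).2.2.2) :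
    HasType g' (l' + l) m (r' + r) := by
  obtain ⟨f, e', hf, h⟩ := h
  let E : ((Fin r' → F) × (Fin l' → F) × (Fin l' → F) × V) ≃ₗ[F]
      (Fin (r' + r) → F) × (Fin (l' + l) → F) × (Fin (l' + l) → F) × (Fin m → F) :=
    { toFun := fun x => (appendLinearEquiv F r' r (x.1, (e' x.2.2.2).1),
        appendLinearEquiv F l' l (x.2.1, (e' x.2.2.2).2.1),
        appendLinearEquiv F l' l (x.2.2.1, (e' x.2.2.2).2.2.1), (e' x.2.2.2).2.2.2)
      map_add' := fun x y => by
        simp only [Prod.fst_add, Prod.snd_add, map_add, ← Prod.mk_add_mk]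
      map_smul' := fun c x => by
        simp only [Prod.smul_fst, Prod.smul_snd, map_smul, RingHom.id_apply, ← Prod.smul_mk]
      invFun := fun x => (((appendLinearEquiv F r' r).symm x.1).1,
        ((appendLinearEquiv F l' l).symm x.2.1).1, ((appendLinearEquiv F l' l).symm x.2.2.1).1,
        e'.symm (((appendLinearEquiv F r' r).symm x.1).2,
          ((appendLinearEquiv F l' l).symm x.2.1).2,
          ((appendLinearEquiv F l' l).symm x.2.2.1).2, x.2.2.2))
      left_inv := fun x => by simp
      right_inv := fun x => by simp }
  refine ⟨f, e ≪≫ₗ E, hf, fun v => ?_⟩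
  simp only [LinearEquiv.trans_apply, E, LinearEquiv.coe_mk, LinearMap.coe_mk, AddHom.coe_mk,
    appendLinearEquiv_dotProduct, hg, h]
  ring

theorem HasType.finrank_eq {g : V → F} {l m r : ℕ} (h : HasType g l m r) :
    Module.finrank F V = r + 2 * l + m := by
  obtain ⟨f, e, hf, h⟩ := h
  rw [e.finrank_eq]
  simp
  ring

theorem hasType_of_anisotropic {m : ℕ} {f : QuadraticForm F (Fin m → F)} (hf : f.Anisotropic)
    (e : V ≃ₗ[F] (Fin m → F)) {g : V → F} (hg : ∀ v, g v = f (e v)) : HasType g 0 m 0 :=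
  ⟨f, { toFun := fun v => (0, 0, 0, e v)
        map_add' := by simp
        map_smul' := by simp
        invFun := fun x => e.symm x.2.2.2
        left_inv := by simp [Function.LeftInverse]
        right_inv := fun x => by
          ext i
          · exact i.elim0
          · exact i.elim0
          · exact i.elim0
          · simp }, hf, fun v => by simp [hg]⟩

/-- The vectors at which a quadratic form vanishes and that are orthogonal to everything. -/
def radSet (g : V → F) : Set V := {v | g v = 0 ∧ ∀ w, g (v + w) = g v + g w}

/-- Testing against the hyperbolic coordinates kills the hyperbolic components of a radical vector;
the form then vanishes at its anisotropic component, which is therefore zero too. Counting the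
radical recovers `r`. -/
theorem HasType.card_radSet [Finite F] {g : V → F} {l m r : ℕ} (h : HasType g l m r) :
    Nat.card (radSet g) = Nat.card F ^ r := by
  obtain ⟨f, e, hf, h⟩ := h
  have key : ∀ v, v ∈ radSet g ↔ (e v).2 = 0 := by
    intro v
    constructor
    · rintro ⟨h0, h1⟩
      have h2 : ∀ w : (Fin r → F) × (Fin l → F) × (Fin l → F) × (Fin m → F),
          (e v).2.1 ⬝ᵥ w.2.2.1 + w.2.1 ⬝ᵥ (e v).2.2.1 + (f ((e v).2.2.2 + w.2.2.2) -
          f (e v).2.2.2 - f w.2.2.2) = 0 := by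
        intro w
        have := h1 (e.symm w)
        simp only [h, map_add, LinearEquiv.apply_symm_apply, Prod.fst_add, Prod.snd_add,
          add_dotProduct, dotProduct_add] at this
        linear_combination this
      have hy : (e v).2.1 = 0 := by
        refine dotProduct_eq_zero _ fun w => ?_
        simpa using h2 (0, 0, w, 0)
      have hz : (e v).2.2.1 = 0 := by
        refine dotProduct_eq_zero _ fun w => ?_
        rw [dotProduct_comm]
        simpa using h2 (0, w, 0, 0)
      have hw : (e v).2.2.2 = 0 := by
        refine hf _ ?_
        rw [h, hy] at h0
        simpa using h0
      ext i <;> simp [hy, hz, hw]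
    · intro h2
      constructor
      · simp [h, h2]
      · intro w
        simp [h, h2]
  have e2 : radSet g ≃ (Fin r → F) :=
    { toFun := fun v => (e v).1
      invFun := fun x => ⟨e.symm (x, 0), by rw [key]; simp⟩
      left_inv := fun v => by
        ext
        have := (key v).1 v.2
        simp only
        rw [← this, Prod.mk.eta, LinearEquiv.symm_apply_apply]
      right_inv := fun x => by simp }
  rw [Nat.card_congr e2, Nat.card_fun]
  simp

theorem card_dotProduct_eq [Fintype F] [DecidableEq F] {l : ℕ} (y : Fin l → F) (hy : y ≠ 0)
    (c : F) : Fintype.card F * Fintype.card {z : Fin l → F // y ⬝ᵥ z = c} = Fintype.card F ^ l := by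
  obtain ⟨i, hi⟩ := Function.ne_iff.1 hy
  have hs : y ⬝ᵥ Pi.single i (y i)⁻¹ = 1 := by
    rw [dotProduct_single]
    exact mul_inv_cancel₀ hi
  have E : F × {z : Fin l → F // y ⬝ᵥ z = c} ≃ (Fin l → F) :=
    { toFun := fun x => x.2.1 + x.1 • Pi.single i (y i)⁻¹
      invFun := fun z => (y ⬝ᵥ z - c, ⟨z - (y ⬝ᵥ z - c) • Pi.single i (y i)⁻¹, by
        rw [dotProduct_sub, dotProduct_smul, hs]; simp⟩)
      left_inv := fun x => by
        have : y ⬝ᵥ (x.2.1 + x.1 • Pi.single i (y i)⁻¹) - c = x.1 := by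
          rw [dotProduct_add, dotProduct_smul, hs, x.2.2]; simp
        ext1
        · exact this
        · ext1
          simp only [this]
          simp
      right_inv := fun z => by simp }
  rw [← Fintype.card_prod, Fintype.card_congr E, Fintype.card_fun, Fintype.card_fin]

/-- Sort the zeros by one half `y` of the hyperbolic coordinates. For `y = 0` the anisotropic
component must vanish; for `y ≠ 0` it is arbitrary and leaves an affine hyperplane for the other
half. Multiplying by the field size avoids `l - 1` in the exponent. -/
theorem HasType.card_zeros [Fintype F] [DecidableEq F] {g : V → F} {l m r : ℕ}
    (h : HasType g l m r) :
    (Fintype.card F : ℤ) * Nat.card {v // g v = 0} =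
      (Fintype.card F : ℤ) ^ (r + l) *
        (((Fintype.card F : ℤ) ^ l - 1) * (Fintype.card F : ℤ) ^ m + Fintype.card F) := by
  obtain ⟨f, e, hf, h⟩ := h
  have e0 : {v // g v = 0} ≃ {x : (Fin r → F) × (Fin l → F) × (Fin l → F) × (Fin m → F) //
      x.2.1 ⬝ᵥ x.2.2.1 = - f x.2.2.2} :=
    e.toEquiv.subtypeEquiv fun v => by rw [h, eq_neg_iff_add_eq_zero]; rfl
  have e1 : {x : (Fin r → F) × (Fin l → F) × (Fin l → F) × (Fin m → F) //
      x.2.1 ⬝ᵥ x.2.2.1 = - f x.2.2.2} ≃ (Fin r → F) × (Σ (y : Fin l → F) (w : Fin m → F),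
      {z : Fin l → F // y ⬝ᵥ z = - f w}) :=
    { toFun := fun x => (x.1.1, ⟨x.1.2.1, x.1.2.2.2, x.1.2.2.1, x.2⟩)
      invFun := fun x => ⟨(x.1, x.2.1, x.2.2.2.1, x.2.2.1), x.2.2.2.2⟩
      left_inv := fun v => rfl
      right_inv := fun x => rfl }
  rw [Nat.card_congr (e0.trans e1), Nat.card_eq_fintype_card, Fintype.card_prod, Fintype.card_sigma,
    ← Finset.add_sum_erase _ _ (Finset.mem_univ (0 : Fin l → F))]
  have hq : (Fintype.card F : ℤ) ≠ 0 := by exact_mod_cast Fintype.card_ne_zero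
  have hA : Fintype.card (Σ (w : Fin m → F), {z : Fin l → F // 0 ⬝ᵥ z = - f w}) =
      Fintype.card F ^ l := by
    rw [Fintype.card_sigma, Finset.sum_eq_single 0]
    · simp
    · intro w _ hw
      have : f w ≠ 0 := fun h => hw (hf w h)
      rw [Fintype.card_eq_zero_iff]
      refine ⟨fun z => this ?_⟩
      simpa using z.2.symm
    · simp
  have hB : ∀ y ∈ Finset.univ.erase (0 : Fin l → F), (Fintype.card F : ℤ) *
      Fintype.card (Σ (w : Fin m → F), {z : Fin l → F // y ⬝ᵥ z = - f w}) =
      Fintype.card F ^ m * Fintype.card F ^ l := by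
    intro y hy
    rw [Fintype.card_sigma]
    push_cast
    have h1 (w : Fin m → F) : (Fintype.card F : ℤ) * Fintype.card {z : Fin l → F // y ⬝ᵥ z = -f w} =
        Fintype.card F ^ l := by
      exact_mod_cast card_dotProduct_eq y (Finset.ne_of_mem_erase hy) (-f w)
    rw [Finset.mul_sum, Finset.sum_congr rfl fun w _ => h1 w]
    simp
  rw [hA]
  push_cast
  rw [mul_left_comm, mul_add, Finset.mul_sum, Finset.sum_congr rfl hB, Finset.sum_const,
    Finset.card_erase_of_mem (Finset.mem_univ _), Finset.card_univ, nsmul_eq_mul]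
  rw [Nat.cast_sub Fintype.card_pos]
  simp only [Fintype.card_fun, Fintype.card_fin]
  push_cast
  ring

/-- The radical gives `r` and the dimension gives `2 * l + m`. Only `m = 0` and `m = 2` can still be
confused, and the number of zeros separates them. -/
theorem HasType.unique [Finite F] {g : V → F} {l m r l' m' r' : ℕ}
    (h : HasType g l m r) (h' : HasType g l' m' r') (hm : m ≤ 2) (hm' : m' ≤ 2) :
    l = l' ∧ m = m' ∧ r = r' := by
  classical
  have := Fintype.ofFinite F
  have hr : r = r' := by
    have := h.card_radSet.symm.trans h'.card_radSet
    exact Nat.pow_right_injective Finite.one_lt_card this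
  subst hr
  have hd := h.finrank_eq.symm.trans h'.finrank_eq
  have hq : (1 : ℤ) < Fintype.card F := by exact_mod_cast Fintype.one_lt_card
  have no : ∀ l : ℕ, HasType g (l + 1) 0 r → HasType g l 2 r → False := by
    intro l h0 h2
    have := h0.card_zeros.symm.trans h2.card_zeros
    generalize (Fintype.card F : ℤ) = q at *
    have hp : q ^ (r + l) ≠ 0 := pow_ne_zero _ (by omega)
    have h3 : q ^ (r + l) * (2 * (q * (q - 1))) = 0 := by
      linear_combination this
    rcases mul_eq_zero.1 h3 with h3 | h3
    · exact hp h3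
    · nlinarith
  interval_cases m <;> interval_cases m' <;> first
    | exact ⟨by omega, rfl, rfl⟩
    | omega
    | skip
  · obtain rfl : l = l' + 1 := by omega
    exact (no _ h h').elim
  · obtain rfl : l' = l + 1 := by omega
    exact (no _ h' h).elim

open Classical in
/-- The pair `(m, r)` such that `g` is the sum of a zero form in `r` variables, of hyperbolic
planes and of an anisotropic quadratic form in `m ≤ 2` variables. -/
noncomputable def formType (g : V → F) : ℕ × ℕ :=
  if h : ∃ x : ℕ × ℕ, x.1 ≤ 2 ∧ ∃ l, HasType g l x.1 x.2 then h.choose else (0, 0)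

theorem HasType.formType_eq [Finite F] {g : V → F} {l m r : ℕ} (h : HasType g l m r)
    (hm : m ≤ 2) : formType g = (m, r) := by
  have hex : ∃ x : ℕ × ℕ, x.1 ≤ 2 ∧ ∃ l, HasType g l x.1 x.2 := ⟨(m, r), hm, l, h⟩
  rw [formType, dif_pos hex]
  obtain ⟨h2, l', h3⟩ := hex.choose_spec
  obtain ⟨-, e1, e2⟩ := h.unique h3 hm h2
  exact Prod.ext e1.symm e2.symm

end HasType

/-! ### Anisotropic binary forms and the ternary forms containing them -/

section SmallForms

open Matrix

variable {F V V' : Type*} [Field F] [AddCommGroup V] [Module F V] [AddCommGroup V'] [Module F V']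

theorem HasType.add_hyperbolic {g : V → F} {l m r : ℕ} (h : HasType g l m r)
    (e : V' ≃ₗ[F] F × F × V) {g' : V' → F}
    (hg : ∀ v, g' v = (e v).1 * (e v).2.1 + g (e v).2.2) : HasType g' (l + 1) m r := by
  let E : (F × F × V) ≃ₗ[F] (Fin 0 → F) × (Fin 1 → F) × (Fin 1 → F) × V :=
    { toFun := fun x => (0, fun _ => x.1, fun _ => x.2.1, x.2.2)
      map_add' := fun x y => Prod.ext (Subsingleton.elim _ _) rfl
      map_smul' := fun c x => Prod.ext (Subsingleton.elim _ _) rfl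
      invFun := fun x => (x.2.1 0, x.2.2.1 0, x.2.2.2)
      left_inv := fun x => rfl
      right_inv := fun x => by
        ext i
        · exact i.elim0
        · simp [Subsingleton.elim i 0]
        · simp [Subsingleton.elim i 0]
        · rfl }
  rw [add_comm l, ← zero_add r]
  exact h.sum 1 0 (e ≪≫ₗ E) fun v => by simp [hg, E, dotProduct]

theorem HasType.add_zero_form {g : V → F} {l m r : ℕ} (h : HasType g l m r)
    (e : V' ≃ₗ[F] F × V) {g' : V' → F} (hg : ∀ v, g' v = g (e v).2) : HasType g' l m (r + 1) := by
  let E : (F × V) ≃ₗ[F] (Fin 1 → F) × (Fin 0 → F) × (Fin 0 → F) × V :=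
    { toFun := fun x => (fun _ => x.1, 0, 0, x.2)
      map_add' := fun x y => Prod.ext rfl
        (Prod.ext (Subsingleton.elim _ _) (Prod.ext (Subsingleton.elim _ _) rfl))
      map_smul' := fun c x => Prod.ext rfl
        (Prod.ext (Subsingleton.elim _ _) (Prod.ext (Subsingleton.elim _ _) rfl))
      invFun := fun x => (x.1 0, x.2.2.2)
      left_inv := fun x => rfl
      right_inv := fun x => by
        ext i
        · simp [Subsingleton.elim i 0]
        · exact i.elim0
        · exact i.elim0
        · rfl }
  rw [add_comm r, ← zero_add l]
  exact h.sum 0 1 (e ≪≫ₗ E) fun v => by simp [hg, E]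

theorem hasType_zero : HasType (fun _ : Fin 0 → F => (0 : F)) 0 0 0 :=
  hasType_of_anisotropic (f := 0) (fun x _ => Subsingleton.elim _ _) (LinearEquiv.refl _ _)
    (fun v => by simp)

theorem hasType_unary {c : F} (hc : c ≠ 0) : HasType (fun x : F => c * x ^ 2) 0 1 0 := by
  refine hasType_of_anisotropic (f := c • QuadraticMap.proj 0 0) (fun x hx => ?_)
    (LinearEquiv.funUnique (Fin 1) F F).symm (fun v => ?_)
  · ext i
    rw [Subsingleton.elim i 0]
    simpa [hc] using hx
  · simp [pow_two]

theorem hasType_binary {a b c : F}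
    (h : ∀ x z, a * x ^ 2 + b * x * z + c * z ^ 2 = 0 → x = 0 ∧ z = 0) :
    HasType (fun x : F × F => a * x.1 ^ 2 + b * x.1 * x.2 + c * x.2 ^ 2) 0 2 0 := by
  refine hasType_of_anisotropic (f := a • QuadraticMap.proj 0 0 + b • QuadraticMap.proj 0 1 +
    c • QuadraticMap.proj 1 1) (fun x hx => ?_) (LinearEquiv.finTwoArrow F F).symm (fun v => ?_)
  · have := h (x 0) (x 1) (by
      rw [← hx]
      simp
      ring)
    ext i
    fin_cases i
    · exact this.1
    · exact this.2
  · simp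
    ring

/-- If the discriminant vanishes, `(-b, 2a)` is a zero. Anisotropy then forces characteristic two
and `b = 0`, where `c / a` is a square and a nontrivial zero exists after all. -/
theorem disc_ne_zero_of_anisotropic [Finite F] {a b c : F}
    (h : ∀ x z, a * x ^ 2 + b * x * z + c * z ^ 2 = 0 → x = 0 ∧ z = 0) :
    4 * a * c - b ^ 2 ≠ 0 := by
  intro hd
  have ha : a ≠ 0 := by
    rintro rfl
    exact one_ne_zero (h 1 0 (by ring)).1
  have h1 := h (-b) (2 * a) (by linear_combination a * hd)
  have h2 : (2 : F) = 0 := (mul_eq_zero.1 h1.2).resolve_right ha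
  have hb : b = 0 := neg_eq_zero.1 h1.1
  have : CharP F 2 := CharTwo.of_one_ne_zero_of_two_eq_zero one_ne_zero h2
  have h3 : IsSquare (c / a) := FiniteField.isSquare_of_char_two (ringChar.eq F 2) _
  obtain ⟨s, hs⟩ := h3
  refine one_ne_zero (h s 1 ?_).2
  rw [hb, pow_two, ← hs]
  field_simp
  linear_combination c * h2

/-- An anisotropic binary form is universal: in characteristic two already `a * x ^ 2` takes every
value, and otherwise two quadratic polynomials are balanced by counting their values. -/
theorem exists_binary_eq [Finite F] {a b c : F}
    (h : ∀ x z, a * x ^ 2 + b * x * z + c * z ^ 2 = 0 → x = 0 ∧ z = 0) {d : F} (hd : d ≠ 0) :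
    ∃ x z, a * x ^ 2 + b * x * z + c * z ^ 2 = -d := by
  have ha : a ≠ 0 := by
    rintro rfl
    exact one_ne_zero (h 1 0 (by ring)).1
  by_cases h2 : ringChar F = 2
  · obtain ⟨s, hs⟩ := FiniteField.isSquare_of_char_two h2 (-d / a)
    refine ⟨s, 0, ?_⟩
    rw [pow_two, ← hs]
    field_simp
    ring
  · have := Fintype.ofFinite F
    obtain ⟨x, y, hxy⟩ := FiniteField.exists_root_sum_quadratic
      (f := Polynomial.C a * Polynomial.X ^ 2 + Polynomial.C b * Polynomial.X + Polynomial.C c)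
      (g := Polynomial.C d * Polynomial.X ^ 2 + Polynomial.C 0 * Polynomial.X + Polynomial.C 0)
      (Polynomial.degree_quadratic ha) (Polynomial.degree_quadratic hd)
      (FiniteField.odd_card_of_char_ne_two h2)
    simp at hxy
    have hy : y ≠ 0 := by
      rintro rfl
      exact one_ne_zero (h x 1 (by linear_combination hxy)).2
    refine ⟨x / y, 1 / y, ?_⟩
    field_simp
    linear_combination hxy

theorem hasType_ternary_aux {b c d : F} (hd : d ≠ 0) (h : b ^ 2 + 4 * d * c ≠ 0) :
    HasType (fun v : F × F × F => -d * v.1 ^ 2 + b * v.1 * v.2.1 + c * v.2.1 ^ 2 + d * v.2.2 ^ 2)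
      1 1 0 := by
  -- With `x, z, y` for the three coordinates, the form is `L * x + d * (y - x) ^ 2 + c * z ^ 2`
  -- with `L = 2d(y - x) + bz`. The choice of `j, k` makes `L` and `M = jz - k(y - x)` unimodular
  -- coordinates on the span of `z` and `y - x`; expanding in them gives `L * (x + αL + γM) + d(b² +
  -- 4dc) * M ^ 2`.
  obtain ⟨j, k, hjk⟩ : ∃ j k : F, j * (2 * d) + k * b = 1 := by
    by_cases hb : b = 0
    · have : 2 * d ≠ 0 := by
        intro h2
        apply h
        rw [hb]
        linear_combination 2 * c * h2
      exact ⟨(2 * d)⁻¹, 0, by rw [inv_mul_cancel₀ this]; ring⟩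
    · exact ⟨0, b⁻¹, by rw [inv_mul_cancel₀ hb]; ring⟩
  have hκ : d * (b ^ 2 + 4 * d * c) ≠ 0 := mul_ne_zero hd h
  let α := d * j ^ 2 + c * k ^ 2
  let γ := -2 * d * j * b + 4 * d * c * k
  let e : (F × F × F) ≃ₗ[F] F × F × F :=
    { toFun := fun v => (2 * d * (v.2.2 - v.1) + b * v.2.1,
        v.1 + α * (2 * d * (v.2.2 - v.1) + b * v.2.1) + γ * (j * v.2.1 - k * (v.2.2 - v.1)),
        j * v.2.1 - k * (v.2.2 - v.1))
      map_add' := fun x y => by ext <;> simp <;> ring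
      map_smul' := fun c x => by ext <;> simp <;> ring
      invFun := fun w => (w.2.1 - α * w.1 - γ * w.2.2, w.1 * k + 2 * d * w.2.2,
        w.2.1 - α * w.1 - γ * w.2.2 + (w.1 * j - b * w.2.2))
      left_inv := fun v => by
        ext
        · simp only
          ring
        · simp only
          linear_combination v.2.1 * hjk
        · simp only
          linear_combination (v.2.2 - v.1) * hjk
      right_inv := fun w => by
        ext
        · simp only
          linear_combination w.1 * hjk
        · simp only
          linear_combination (α * w.1 + γ * w.2.2) * hjk
        · simp only
          linear_combination w.2.2 * hjk }
  refine (hasType_unary hκ).add_hyperbolic e fun v => ?_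
  have hz : v.2.1 = (2 * d * (v.2.2 - v.1) + b * v.2.1) * k +
      2 * d * (j * v.2.1 - k * (v.2.2 - v.1)) := by
    linear_combination -v.2.1 * hjk
  have hy : v.2.2 - v.1 = (2 * d * (v.2.2 - v.1) + b * v.2.1) * j -
      b * (j * v.2.1 - k * (v.2.2 - v.1)) := by
    linear_combination -(v.2.2 - v.1) * hjk
  have e1 : -d * v.1 ^ 2 + b * v.1 * v.2.1 + c * v.2.1 ^ 2 + d * v.2.2 ^ 2 =
      (2 * d * (v.2.2 - v.1) + b * v.2.1) * v.1 + (d * (v.2.2 - v.1) ^ 2 + c * v.2.1 ^ 2) := by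
    ring
  have e2 : d * (v.2.2 - v.1) ^ 2 + c * v.2.1 ^ 2 =
      d * ((2 * d * (v.2.2 - v.1) + b * v.2.1) * j - b * (j * v.2.1 - k * (v.2.2 - v.1))) ^ 2 +
      c * ((2 * d * (v.2.2 - v.1) + b * v.2.1) * k +
        2 * d * (j * v.2.1 - k * (v.2.2 - v.1))) ^ 2 := by
    rw [← hz, ← hy]
  rw [e1, e2]
  simp only [e, α, γ, LinearEquiv.coe_mk, LinearMap.coe_mk, AddHom.coe_mk]
  ring

/-- The binary part represents `-d`. A unimodular change of basis starting with such a vector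
preserves the discriminant and leads to `hasType_ternary_aux`. -/
theorem hasType_ternary [Finite F] {a b c d : F}
    (h : ∀ x z, a * x ^ 2 + b * x * z + c * z ^ 2 = 0 → x = 0 ∧ z = 0) (hd : d ≠ 0)
    (e : V ≃ₗ[F] F × F × F) {g : V → F} (hg : ∀ v, g v = a * (e v).1 ^ 2 +
      b * (e v).1 * (e v).2.1 + c * (e v).2.1 ^ 2 + d * (e v).2.2 ^ 2) : HasType g 1 1 0 := by
  obtain ⟨s, t, hst⟩ := exists_binary_eq h hd
  obtain ⟨k, n, hkn⟩ : ∃ k n : F, s * n - t * k = 1 := by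
    by_cases hs : s = 0
    · have : t ≠ 0 := by
        rintro rfl
        apply hd
        rw [hs] at hst
        linear_combination hst
      exact ⟨-t⁻¹, 0, by rw [mul_neg, mul_inv_cancel₀ this]; ring⟩
    · exact ⟨0, s⁻¹, by rw [mul_inv_cancel₀ hs]; ring⟩
  have hdisc := disc_ne_zero_of_anisotropic h
  let b' := 2 * a * s * k + b * (s * n + t * k) + 2 * c * t * n
  let c' := a * k ^ 2 + b * k * n + c * n ^ 2
  have h' : b' ^ 2 + 4 * d * c' ≠ 0 := by
    have : b' ^ 2 + 4 * d * c' = -(4 * a * c - b ^ 2) := by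
      simp only [b', c']
      linear_combination (4 * (a * k ^ 2 + b * k * n + c * n ^ 2)) * hst +
        (b ^ 2 - 4 * a * c) * (s * n - t * k + 1) * hkn
    rw [this]
    exact neg_ne_zero.2 hdisc
  let E : (F × F × F) ≃ₗ[F] F × F × F :=
    { toFun := fun v => (n * v.1 - k * v.2.1, s * v.2.1 - t * v.1, v.2.2)
      map_add' := fun x y => by ext <;> simp <;> ring
      map_smul' := fun c x => by ext <;> simp <;> ring
      invFun := fun w => (s * w.1 + k * w.2.1, t * w.1 + n * w.2.1, w.2.2)
      left_inv := fun v => by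
        ext
        · simp only
          linear_combination v.1 * hkn
        · simp only
          linear_combination v.2.1 * hkn
        · rfl
      right_inv := fun w => by
        ext
        · simp only
          linear_combination w.1 * hkn
        · simp only
          linear_combination w.2.1 * hkn
        · rfl }
  refine (hasType_ternary_aux hd h').comp_equiv (e ≪≫ₗ E) fun v => ?_
  rw [hg]
  simp only [LinearEquiv.trans_apply]
  generalize e v = w
  have hx : w.1 = s * (n * w.1 - k * w.2.1) + k * (s * w.2.1 - t * w.1) := by
    linear_combination -w.1 * hkn
  have hz : w.2.1 = t * (n * w.1 - k * w.2.1) + n * (s * w.2.1 - t * w.1) := by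
    linear_combination -w.2.1 * hkn
  simp only [E, LinearEquiv.coe_mk, LinearMap.coe_mk, AddHom.coe_mk]
  generalize n * w.1 - k * w.2.1 = X at *
  generalize s * w.2.1 - t * w.1 = Z at *
  rw [hx, hz]
  simp only [b', c']
  linear_combination X ^ 2 * hst

end SmallForms

/-! ### Adding one variable to an anisotropic form -/

open Matrix in
/-- The extension `g(x) + t (b · x) + a t²` of `g` by one variable `t`. -/
def extForm {F : Type*} [Field F] {k : ℕ} (g : (Fin k → F) → F) (b : Fin k → F) (a : F) :
    (Fin k → F) × F → F :=
  fun x => g x.1 + x.2 * (b ⬝ᵥ x.1) + a * x.2 ^ 2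

section SmallExtensions

open Matrix

variable {F : Type*} [Field F]

theorem exists_coeff_unary (f : QuadraticForm F (Fin 1 → F)) : ∃ u : F, ∀ x, f x = u * x 0 ^ 2 := by
  refine ⟨f 1, fun x => ?_⟩
  have : x = x 0 • (1 : Fin 1 → F) := by
    ext i
    simp [Subsingleton.elim i 0]
  conv_lhs => rw [this, QuadraticMap.map_smul]
  simp only [smul_eq_mul]
  ring

theorem exists_coeff_binary (f : QuadraticForm F (Fin 2 → F)) :
    ∃ a b c : F, ∀ x, f x = a * x 0 ^ 2 + b * x 0 * x 1 + c * x 1 ^ 2 := by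
  refine ⟨f ![1, 0], QuadraticMap.polar f ![1, 0] ![0, 1], f ![0, 1], fun x => ?_⟩
  have : x = x 0 • ![1, 0] + x 1 • ![0, 1] := by
    ext i
    fin_cases i <;> simp
  conv_lhs => rw [this, QuadraticMap.map_add f, QuadraticMap.map_smul, QuadraticMap.map_smul,
    QuadraticMap.polar_smul_left, QuadraticMap.polar_smul_right]
  simp only [smul_eq_mul]
  ring

theorem hasType_extForm_zero [DecidableEq F] {f : QuadraticForm F (Fin 0 → F)} (b : Fin 0 → F) (a : F) :
    if a = 0 then HasType (extForm f b a) 0 0 1 else HasType (extForm f b a) 0 1 0 := by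
  have hf : ∀ x, f x = 0 := fun x => by rw [Subsingleton.elim x 0, QuadraticMap.map_zero]
  split_ifs with ha
  · refine hasType_zero.add_zero_form (LinearEquiv.prodComm F _ _) fun v => ?_
    simp [extForm, hf, ha, dotProduct]
  · refine (hasType_unary ha).comp_equiv
      (LinearEquiv.ofBijective (LinearMap.snd F (Fin 0 → F) F) ⟨fun x y h => ?_, fun y => ?_⟩)
      fun v => ?_
    · exact Prod.ext (Subsingleton.elim _ _) h
    · exact ⟨(0, y), rfl⟩
    · simp only [extForm, hf, dotProduct, Finset.univ_eq_empty, Finset.sum_empty, mul_zero, zero_add]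
      rfl

theorem hasType_one_no_root {f : QuadraticForm F (Fin 1 → F)} {u : F} (hu : u ≠ 0)
    (hf : ∀ x, f x = u * x 0 ^ 2) (b : Fin 1 → F) (a : F)
    (h : ∀ t, u * t ^ 2 + b 0 * t + a ≠ 0) : HasType (extForm f b a) 0 2 0 := by
  refine (hasType_binary (a := u) (b := b 0) (c := a) fun x z hxz => ?_).comp_equiv
    (LinearEquiv.prodCongr (LinearEquiv.funUnique (Fin 1) F F) (LinearEquiv.refl F F)) fun v => ?_
  · have hz : z = 0 := by
      by_contra hz
      refine h (x / z) ?_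
      field_simp
      linear_combination hxz
    subst hz
    simpa [hu] using hxz
  · simp [extForm, hf, dotProduct]
    ring

/-- In the coordinate `y = x - t * z` the form is `y * (u * y + (2 * u * t + b 0) * z)`: a double
root leaves a square and a radical vector, a simple root a hyperbolic plane. -/
theorem hasType_one_root [DecidableEq F] {f : QuadraticForm F (Fin 1 → F)} {u : F} (hu : u ≠ 0)
    (hf : ∀ x, f x = u * x 0 ^ 2) (b : Fin 1 → F) (a t : F)
    (h : u * t ^ 2 + b 0 * t + a = 0) :
    if 2 * u * t + b 0 = 0 then HasType (extForm f b a) 0 1 1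
    else HasType (extForm f b a) 1 0 0 := by
  split_ifs with hc
  · let e : ((Fin 1 → F) × F) ≃ₗ[F] F × F :=
      { toFun := fun v => (v.2, v.1 0 - t * v.2)
        map_add' := fun x y => by ext <;> simp <;> ring
        map_smul' := fun c x => by ext <;> simp <;> ring
        invFun := fun w => (fun _ => w.2 + t * w.1, w.1)
        left_inv := fun v => by
          ext i
          · simp [Subsingleton.elim i 0]
          · rfl
        right_inv := fun w => by ext <;> simp }
    refine (hasType_unary hu).add_zero_form e fun v => ?_
    simp only [extForm, hf, dotProduct, Finset.univ_unique, Fin.default_eq_zero,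
      Finset.sum_singleton, e, LinearEquiv.coe_mk, LinearMap.coe_mk, AddHom.coe_mk]
    linear_combination v.2 ^ 2 * h + (v.1 0 * v.2 - t * v.2 ^ 2) * hc
  · let e : ((Fin 1 → F) × F) ≃ₗ[F] F × F × (Fin 0 → F) :=
      { toFun := fun v => (v.1 0 - t * v.2, u * (v.1 0 - t * v.2) + (2 * u * t + b 0) * v.2, 0)
        map_add' := fun x y => by
          ext
          · simp
            ring
          · simp
            ring
          · exact congrFun (Subsingleton.elim (α := Fin 0 → F) _ _) _
        map_smul' := fun c x => by
          ext
          · simp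
            ring
          · simp
            ring
          · exact congrFun (Subsingleton.elim (α := Fin 0 → F) _ _) _
        invFun := fun w => (fun _ => w.1 + t * ((w.2.1 - u * w.1) / (2 * u * t + b 0)),
          (w.2.1 - u * w.1) / (2 * u * t + b 0))
        left_inv := fun v => by
          ext i
          · simp [Subsingleton.elim i 0, hc]
          · simp [hc]
        right_inv := fun w => by
          ext i
          · simp
          · simp only [add_sub_cancel_right]
            rw [mul_div_cancel₀ _ hc]
            ring
          · exact i.elim0 }
    refine hasType_zero.add_hyperbolic e fun v => ?_
    simp only [extForm, hf, dotProduct, Finset.univ_unique, Fin.default_eq_zero,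
      Finset.sum_singleton, e, LinearEquiv.coe_mk, LinearMap.coe_mk, AddHom.coe_mk]
    linear_combination v.2 ^ 2 * h

theorem hasType_extForm_two [Finite F] [DecidableEq F] {f : QuadraticForm F (Fin 2 → F)} (hf : f.Anisotropic)
    (b : Fin 2 → F) : ∃ c, ∀ a, if a = c then HasType (extForm f b a) 0 2 1
      else HasType (extForm f b a) 1 1 0 := by
  obtain ⟨A, B, C, hABC⟩ := exists_coeff_binary f
  have haniso : ∀ x z, A * x ^ 2 + B * x * z + C * z ^ 2 = 0 → x = 0 ∧ z = 0 := by
    intro x z hxz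
    have h0 := hf ![x, z] (by rw [hABC]; simpa using hxz)
    exact ⟨by simpa using congrFun h0 0, by simpa using congrFun h0 1⟩
  have hd := disc_ne_zero_of_anisotropic haniso
  -- The Gram determinant `4AC - B²` is nonzero, so the cross terms can be removed by translation in
  -- every characteristic, including two.
  obtain ⟨s, t, hs, ht⟩ : ∃ s t, 2 * A * s + B * t = b 0 ∧ B * s + 2 * C * t = b 1 := by
    refine ⟨(2 * C * b 0 - B * b 1) * (4 * A * C - B ^ 2)⁻¹,
      (2 * A * b 1 - B * b 0) * (4 * A * C - B ^ 2)⁻¹, ?_, ?_⟩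
    · linear_combination b 0 * mul_inv_cancel₀ hd
    · linear_combination b 1 * mul_inv_cancel₀ hd
  let e : ((Fin 2 → F) × F) ≃ₗ[F] F × F × F :=
    { toFun := fun v => (v.1 0 + s * v.2, v.1 1 + t * v.2, v.2)
      map_add' := fun x y => by ext <;> simp <;> ring
      map_smul' := fun c x => by ext <;> simp <;> ring
      invFun := fun w => (![w.1 - s * w.2.2, w.2.1 - t * w.2.2], w.2.2)
      left_inv := fun v => by
        ext i
        · fin_cases i <;> simp
        · rfl
      right_inv := fun w => by ext <;> simp }
  have hext : ∀ a v, extForm f b a v = A * (e v).1 ^ 2 + B * (e v).1 * (e v).2.1 +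
      C * (e v).2.1 ^ 2 + (a - (A * s ^ 2 + B * s * t + C * t ^ 2)) * (e v).2.2 ^ 2 := by
    intro a v
    simp only [extForm, hABC, dotProduct, Fin.sum_univ_two, ← hs, ← ht, e, LinearEquiv.coe_mk,
      LinearMap.coe_mk, AddHom.coe_mk]
    ring
  refine ⟨A * s ^ 2 + B * s * t + C * t ^ 2, fun a => ?_⟩
  split_ifs with ha
  · let E : (F × F × F) ≃ₗ[F] F × F × F :=
      { toFun := fun v => (v.2.2, v.1, v.2.1)
        map_add' := fun x y => rfl
        map_smul' := fun c x => rfl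
        invFun := fun v => (v.2.1, v.2.2, v.1)
        left_inv := fun v => rfl
        right_inv := fun v => rfl }
    refine (hasType_binary haniso).add_zero_form (e ≪≫ₗ E) fun v => ?_
    rw [hext, ha]
    simp [E]
  · exact hasType_ternary haniso (sub_ne_zero.2 ha) e (hext a)

end SmallExtensions

/-! ### Averages over the one-variable extensions -/

section SmallExtensionSums

variable {F : Type*} [Field F] [Fintype F] [DecidableEq F]

theorem sum_ite_eq_add {α : Type*} [Fintype α] [DecidableEq α] (c : α) (x y : ℝ) :
    ∑ a, (if a = c then x else y) = x + ((Fintype.card α : ℝ) - 1) * y := by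
  have : ∀ a, (if a = c then x else y) = y + if a = c then x - y else 0 := by
    intro a
    split_ifs <;> ring
  rw [Finset.sum_congr rfl fun a _ => this a, Finset.sum_add_distrib, Finset.sum_ite_eq']
  simp
  ring

theorem card_filter_root {u : F} (hu : u ≠ 0) (b a t : F) (h : u * t ^ 2 + b * t + a = 0) :
    (Finset.univ.filter fun s => u * s ^ 2 + b * s + a = 0).card =
        (if 2 * u * t + b = 0 then 1 else 2) ∧
      (Finset.univ.filter fun s => b = -2 * u * s ∧ a = u * s ^ 2).card =
        (if 2 * u * t + b = 0 then 1 else 0) := by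
  have h1 : ∀ s, u * s ^ 2 + b * s + a = 0 ↔ s = t ∨ s = -t - b / u := by
    intro s
    have : u * s ^ 2 + b * s + a = u * ((s - t) * (s - (-t - b / u))) := by
      field_simp
      linear_combination h
    rw [this, mul_eq_zero, mul_eq_zero, sub_eq_zero, sub_eq_zero]
    simp [hu]
  have h2 : t = -t - b / u ↔ 2 * u * t + b = 0 := by
    constructor
    · intro h
      field_simp at h
      linear_combination h
    · intro h
      field_simp
      linear_combination h
  constructor
  · have : (Finset.univ.filter fun s => u * s ^ 2 + b * s + a = 0) = {t, -t - b / u} := by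
      ext s
      simp [h1]
    rw [this]
    split_ifs with hc
    · rw [← h2.2 hc]
      simp
    · exact Finset.card_pair fun h => hc (h2.1 h)
  · have h3 : ∀ s, b = -2 * u * s ∧ a = u * s ^ 2 → 2 * u * t + b = 0 ∧ s = t := by
      rintro s ⟨hb, ha⟩
      have hr : u * (t - s) ^ 2 = 0 := by
        rw [hb, ha] at h
        linear_combination h
      have : t - s = 0 := by simpa [hu] using hr
      have : t = s := by linear_combination this
      subst this
      exact ⟨by rw [hb]; ring, rfl⟩
    split_ifs with hc
    · rw [Finset.card_eq_one]
      refine ⟨t, ?_⟩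
      ext s
      simp only [Finset.mem_filter, Finset.mem_univ, true_and, Finset.mem_singleton]
      refine ⟨fun hs => (h3 s hs).2, ?_⟩
      rintro rfl
      exact ⟨by linear_combination hc, by linear_combination h - s * hc⟩
    · rw [Finset.card_eq_zero, Finset.filter_eq_empty_iff]
      exact fun s _ hs => hc (h3 s hs).1

theorem sum_root_count {u : F} (hu : u ≠ 0) (x y z : ℝ) (g : F → F → ℝ)
    (h0 : ∀ b a, (∀ t, u * t ^ 2 + b * t + a ≠ 0) → g b a = x)
    (h1 : ∀ b a t, u * t ^ 2 + b * t + a = 0 → g b a = if 2 * u * t + b = 0 then y else z) :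
    ∑ b, ∑ a, g b a = (Fintype.card F : ℝ) * y +
      (Fintype.card F : ℝ) * ((Fintype.card F : ℝ) - 1) * ((x + z) / 2) := by
  -- Interpolate `g` linearly in the number of roots and the indicator of a double root. Over all
  -- `(b, a)` these sum to `q ^ 2` and `q`, where `q` is the field size, so irreducible and split
  -- quadratics turn out equally frequent.
  have key : ∀ b a, g b a = x + (z - x) / 2 *
      ∑ t, (if u * t ^ 2 + b * t + a = 0 then 1 else 0) +
      (y - (z + x) / 2) * ∑ t, (if b = -2 * u * t ∧ a = u * t ^ 2 then 1 else 0) := by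
    intro b a
    rw [Finset.sum_boole, Finset.sum_boole]
    by_cases h : ∃ t, u * t ^ 2 + b * t + a = 0
    · obtain ⟨t, ht⟩ := h
      rw [h1 b a t ht, (card_filter_root hu b a t ht).1, (card_filter_root hu b a t ht).2]
      split_ifs
      · push_cast
        ring
      · push_cast
        ring
    · push Not at h
      rw [h0 b a h, Finset.filter_eq_empty_iff.2 fun t _ => h t, Finset.filter_eq_empty_iff.2]
      · simp
      · rintro t - ⟨hb, ha⟩
        refine h t ?_
        rw [hb, ha]
        ring
  have e1 : ∑ b : F, ∑ a : F, ∑ t : F, (if u * t ^ 2 + b * t + a = 0 then (1 : ℝ) else 0) =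
      (Fintype.card F : ℝ) ^ 2 := by
    have : ∀ b : F, ∑ a : F, ∑ t : F, (if u * t ^ 2 + b * t + a = 0 then (1 : ℝ) else 0) =
        Fintype.card F := by
      intro b
      rw [Finset.sum_comm]
      have : ∀ t a : F, (u * t ^ 2 + b * t + a = 0) = (a = -(u * t ^ 2 + b * t)) := fun t a => by
        rw [eq_neg_iff_add_eq_zero, add_comm a]
      simp [this]
    rw [Finset.sum_congr rfl fun b _ => this b]
    simp [pow_two]
  have e2 : ∑ b : F, ∑ a : F, ∑ t : F,
      (if b = -2 * u * t ∧ a = u * t ^ 2 then (1 : ℝ) else 0) = Fintype.card F := by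
    have : ∀ b : F, ∑ a : F, ∑ t : F, (if b = -2 * u * t ∧ a = u * t ^ 2 then (1 : ℝ) else 0) =
        ∑ t : F, if b = -2 * u * t then 1 else 0 := by
      intro b
      rw [Finset.sum_comm]
      refine Finset.sum_congr rfl fun t _ => ?_
      simp only [ite_and]
      split_ifs <;> simp
    rw [Finset.sum_congr rfl fun b _ => this b, Finset.sum_comm]
    simp
  simp only [key, Finset.sum_add_distrib, ← Finset.mul_sum, e1, e2]
  simp
  ring

/-- The average of `v` over the types obtained from an anisotropic form in `m` variables by adding
one variable, over a field with `q` elements. -/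
noncomputable def anisotropicStep (q : ℝ) (v : ℕ × ℕ → ℝ) (m : ℕ) : ℝ :=
  q⁻¹ * v (m, 1) + (1 - q⁻¹) * (if m = 1 then (v (0, 0) + v (2, 0)) / 2 else v (1, 0))

theorem exists_hasType_extForm {m : ℕ} (hm : m ≤ 2) {f : QuadraticForm F (Fin m → F)}
    (hf : f.Anisotropic) (b : Fin m → F) (a : F) :
    ∃ l' m' r', m' ≤ 2 ∧ HasType (extForm f b a) l' m' r' := by
  interval_cases m
  · have := hasType_extForm_zero (f := f) b a
    split_ifs at this
    · exact ⟨_, _, _, by norm_num, this⟩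
    · exact ⟨_, _, _, by norm_num, this⟩
  · obtain ⟨u, hu⟩ := exists_coeff_unary f
    have hu0 : u ≠ 0 := by
      rintro rfl
      have := congrFun (hf 1 (by rw [hu]; simp)) 0
      simp at this
    by_cases h : ∃ t, u * t ^ 2 + b 0 * t + a = 0
    · obtain ⟨t, ht⟩ := h
      have := hasType_one_root hu0 hu b a t ht
      split_ifs at this
      · exact ⟨_, _, _, by norm_num, this⟩
      · exact ⟨_, _, _, by norm_num, this⟩
    · push Not at h
      exact ⟨_, _, _, le_rfl, hasType_one_no_root hu0 hu b a h⟩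
  · obtain ⟨c, hc⟩ := hasType_extForm_two hf b
    have := hc a
    split_ifs at this
    · exact ⟨_, _, _, le_rfl, this⟩
    · exact ⟨_, _, _, by norm_num, this⟩

theorem sum_formType_extForm_anisotropic {m : ℕ} (hm : m ≤ 2) {f : QuadraticForm F (Fin m → F)}
    (hf : f.Anisotropic) (v : ℕ × ℕ → ℝ) :
    ∑ b, ∑ a, v (formType (extForm f b a)) =
      (Fintype.card F : ℝ) ^ (m + 1) * anisotropicStep (Fintype.card F) v m := by
  have hq : (Fintype.card F : ℝ) ≠ 0 := by exact_mod_cast Fintype.card_ne_zero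
  interval_cases m
  · have h : ∀ b a, v (formType (extForm f b a)) = if a = 0 then v (0, 1) else v (1, 0) := by
      intro b a
      have := hasType_extForm_zero (f := f) b a
      split_ifs at this ⊢
      · rw [this.formType_eq (by norm_num)]
      · rw [this.formType_eq (by norm_num)]
    simp only [h, sum_ite_eq_add, anisotropicStep]
    simp
    field_simp
  · obtain ⟨u, hu⟩ := exists_coeff_unary f
    have hu0 : u ≠ 0 := by
      rintro rfl
      have := congrFun (hf 1 (by rw [hu]; simp)) 0
      simp at this
    rw [← Equiv.sum_comp (Equiv.funUnique (Fin 1) F).symm, sum_root_count hu0 (v (2, 0)) (v (1, 1))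
      (v (0, 0))]
    · simp [anisotropicStep]
      field_simp
      ring
    · intro b a h
      rw [(hasType_one_no_root hu0 hu _ a (by simpa using h)).formType_eq le_rfl]
    · intro b a t h
      have := hasType_one_root hu0 hu ((Equiv.funUnique (Fin 1) F).symm b) a t (by simpa using h)
      have hb : (Equiv.funUnique (Fin 1) F).symm b 0 = b := rfl
      rw [hb] at this
      split_ifs at this ⊢
      · rw [this.formType_eq (by norm_num)]
      · rw [this.formType_eq (by norm_num)]
  · have h : ∀ b, ∑ a, v (formType (extForm f b a)) =
        v (2, 1) + ((Fintype.card F : ℝ) - 1) * v (1, 0) := by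
      intro b
      obtain ⟨c, hc⟩ := hasType_extForm_two hf b
      rw [← sum_ite_eq_add c]
      refine Finset.sum_congr rfl fun a _ => ?_
      have := hc a
      split_ifs at this ⊢
      · rw [this.formType_eq (by norm_num)]
      · rw [this.formType_eq (by norm_num)]
    simp only [h, anisotropicStep]
    simp
    field_simp

end SmallExtensionSums

/-! ### The transition of types for an arbitrary form -/

section Transition

open Matrix

variable {F : Type*} [Field F]

/-- The coordinate space of a form of type `(l, m, r)`. -/
abbrev TypeCoords (F : Type*) (r l m : ℕ) : Type _ :=
  (Fin r → F) × (Fin l → F) × (Fin l → F) × (Fin m → F)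

/-- The standard bilinear form on `TypeCoords`. -/
def coordsDot {r l m : ℕ} (s x : TypeCoords F r l m) : F :=
  s.1 ⬝ᵥ x.1 + s.2.1 ⬝ᵥ x.2.1 + s.2.2.1 ⬝ᵥ x.2.2.1 + s.2.2.2 ⬝ᵥ x.2.2.2

/-- The extension by one variable of the standard form of type `(l, m, r)`. -/
def extCoordsForm {r l m : ℕ} (f : QuadraticForm F (Fin m → F)) (s : TypeCoords F r l m) (a : F) :
    TypeCoords F r l m × F → F :=
  fun x => x.1.2.1 ⬝ᵥ x.1.2.2.1 + f x.1.2.2.2 + x.2 * coordsDot s x.1 + a * x.2 ^ 2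

theorem exists_linearEquiv_dotProduct {r : ℕ} {y : Fin r → F} (hy : y ≠ 0) :
    ∃ e : (Fin r → F) ≃ₗ[F] (Fin (r - 1) → F) × F, ∀ x, (e x).2 = y ⬝ᵥ x := by
  obtain ⟨i, hi⟩ := Function.ne_iff.1 hy
  obtain ⟨k, rfl⟩ : ∃ k, r = k + 1 := ⟨r - 1, by have := i.2; omega⟩
  let φ : (Fin (k + 1) → F) →ₗ[F] (Fin k → F) × F :=
    { toFun := fun x => (fun j => x (i.succAbove j), y ⬝ᵥ x)
      map_add' := fun x z => by ext <;> simp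
      map_smul' := fun c x => by ext <;> simp }
  have hφ : Function.Injective φ := by
    rw [← LinearMap.ker_eq_bot, LinearMap.ker_eq_bot']
    intro x hx
    have h1 : ∀ j, x (i.succAbove j) = 0 := fun j => congrFun (congrArg Prod.fst hx) j
    have h2 : y ⬝ᵥ x = 0 := congrArg Prod.snd hx
    rw [dotProduct, Fin.sum_univ_succAbove _ i] at h2
    simp only [h1, mul_zero, Finset.sum_const_zero, add_zero] at h2
    have h3 : x i = 0 := (mul_eq_zero.1 h2).resolve_left hi
    ext j
    rcases Fin.eq_self_or_eq_succAbove i j with rfl | ⟨j, rfl⟩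
    · exact h3
    · exact h1 j
  exact ⟨LinearEquiv.ofInjectiveOfFinrankEq φ hφ (by simp), fun x => rfl⟩

theorem add_smul_dotProduct_add_smul {l : ℕ} (y z α β : Fin l → F) (t : F) :
    (y + t • β) ⬝ᵥ (z + t • α) =
      y ⬝ᵥ z + t * (α ⬝ᵥ y) + t * (β ⬝ᵥ z) + t ^ 2 * (α ⬝ᵥ β) := by
  simp only [add_dotProduct, dotProduct_add, smul_dotProduct, dotProduct_smul, smul_eq_mul]
  rw [dotProduct_comm y α, dotProduct_comm β α]
  ring

/-- A linear form that is nonzero on the radical supplies a coordinate which, after absorbing all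
terms containing the new variable, forms a hyperbolic plane with that variable. -/
theorem hasType_extCoordsForm_of_ne {r l m : ℕ} {f : QuadraticForm F (Fin m → F)}
    (hf : f.Anisotropic) (s : TypeCoords F r l m) (hs : s.1 ≠ 0) (a : F) :
    HasType (extCoordsForm f s a) (l + 1) m (r - 1) := by
  obtain ⟨ε, hε⟩ := exists_linearEquiv_dotProduct hs
  have base : HasType (fun v : F × F × (Fin m → F) => v.1 * v.2.1 + f v.2.2) (0 + 1) m 0 :=
    (hasType_of_anisotropic hf (LinearEquiv.refl F _) fun v => rfl).add_hyperbolic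
      (LinearEquiv.refl F _) fun v => rfl
  let e : (TypeCoords F r l m × F) ≃ₗ[F]
      (Fin (r - 1) → F) × (Fin l → F) × (Fin l → F) × (F × F × (Fin m → F)) :=
    { toFun := fun v => ((ε v.1.1).1, v.1.2.1 + v.2 • s.2.2.1, v.1.2.2.1 + v.2 • s.2.1, v.2,
        (ε v.1.1).2 + s.2.2.2 ⬝ᵥ v.1.2.2.2 + (a - s.2.1 ⬝ᵥ s.2.2.1) * v.2, v.1.2.2.2)
      map_add' := fun x y => by
        ext <;> simp [add_mul] <;> ring
      map_smul' := fun c x => by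
        ext <;> simp <;> ring
      invFun := fun w => ((ε.symm (w.1, w.2.2.2.2.1 - s.2.2.2 ⬝ᵥ w.2.2.2.2.2 -
        (a - s.2.1 ⬝ᵥ s.2.2.1) * w.2.2.2.1), w.2.1 - w.2.2.2.1 • s.2.2.1,
        w.2.2.1 - w.2.2.2.1 • s.2.1, w.2.2.2.2.2), w.2.2.2.1)
      left_inv := fun v => by
        have (x y z : F) : x + y + z - y - z = x := by ring
        simp [this]
      right_inv := fun w => by
        have (x y z : F) : x - y - z + y + z = x := by ring
        simp [this] }
  refine base.sum l (r - 1) e fun v => ?_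
  simp only [extCoordsForm, coordsDot, e, LinearEquiv.coe_mk, LinearMap.coe_mk, AddHom.coe_mk,
    add_smul_dotProduct_add_smul, hε]
  ring

/-- A translation of the hyperbolic coordinates absorbs the hyperbolic part of the linear form and
changes `a` by the dot product of its two halves; only the anisotropic part is then extended. -/
theorem hasType_extCoordsForm_of_eq {r l m l' m' r' : ℕ} {f : QuadraticForm F (Fin m → F)}
    (s : TypeCoords F r l m) (hs : s.1 = 0) (a : F)
    (h : HasType (extForm f s.2.2.2 (a - s.2.1 ⬝ᵥ s.2.2.1)) l' m' r') :
    HasType (extCoordsForm f s a) (l + l') m' (r + r') := by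
  let e : (TypeCoords F r l m × F) ≃ₗ[F]
      (Fin r → F) × (Fin l → F) × (Fin l → F) × ((Fin m → F) × F) :=
    { toFun := fun v => (v.1.1, v.1.2.1 + v.2 • s.2.2.1, v.1.2.2.1 + v.2 • s.2.1, v.1.2.2.2, v.2)
      map_add' := fun x y => by
        ext <;> simp [add_mul] <;> ring
      map_smul' := fun c x => by
        ext <;> simp <;> ring
      invFun := fun w => ((w.1, w.2.1 - w.2.2.2.2 • s.2.2.1, w.2.2.1 - w.2.2.2.2 • s.2.1,
        w.2.2.2.1), w.2.2.2.2)
      left_inv := fun v => by simp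
      right_inv := fun w => by simp }
  refine h.sum l r e fun v => ?_
  simp only [extCoordsForm, extForm, coordsDot, e, LinearEquiv.coe_mk, LinearMap.coe_mk,
    AddHom.coe_mk, add_smul_dotProduct_add_smul, hs, zero_dotProduct]
  ring

/-- Taking the dual of the coordinate change is a bijection on linear forms, so a uniform choice of
new cross coefficients stays uniform in adapted coordinates. -/
theorem exists_equiv_coordsDot {n r l m : ℕ} (e : (Fin n → F) ≃ₗ[F] TypeCoords F r l m) :
    ∃ τ : TypeCoords F r l m ≃ (Fin n → F), ∀ s v, τ s ⬝ᵥ v = coordsDot s (e v) := by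
  let D (s : TypeCoords F r l m) : TypeCoords F r l m →ₗ[F] F :=
    { toFun := coordsDot s
      map_add' := fun x y => by simp [coordsDot]; ring
      map_smul' := fun c x => by simp [coordsDot]; ring }
  let σ : TypeCoords F r l m →ₗ[F] (Fin n → F) :=
    { toFun := fun s i => D s (e (Pi.single i 1))
      map_add' := fun x y => by ext i; simp [D, coordsDot]; ring
      map_smul' := fun c x => by ext i; simp [D, coordsDot]; ring }
  have hσ : ∀ s v, σ s ⬝ᵥ v = coordsDot s (e v) := by
    intro s v
    have : v = ∑ i, v i • Pi.single i (1 : F) := by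
      ext j
      simp [Finset.sum_apply, Pi.single_apply]
    change _ = D s (e v)
    conv_rhs => rw [this]
    rw [map_sum, map_sum]
    refine Finset.sum_congr rfl fun i _ => ?_
    rw [map_smul, map_smul, smul_eq_mul, mul_comm]
    rfl
  have hinj : Function.Injective σ := by
    rw [← LinearMap.ker_eq_bot, LinearMap.ker_eq_bot']
    intro s h
    have h0 : ∀ x, coordsDot s x = 0 := by
      intro x
      rw [← e.apply_symm_apply x, ← hσ, h, zero_dotProduct]
    have h1 : s.1 = 0 := dotProduct_eq_zero _ fun w => by simpa [coordsDot] using h0 (w, 0, 0, 0)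
    have h2 : s.2.1 = 0 := dotProduct_eq_zero _ fun w => by simpa [coordsDot] using h0 (0, w, 0, 0)
    have h3 : s.2.2.1 = 0 := dotProduct_eq_zero _ fun w => by
      simpa [coordsDot] using h0 (0, 0, w, 0)
    have h4 : s.2.2.2 = 0 := dotProduct_eq_zero _ fun w => by
      simpa [coordsDot] using h0 (0, 0, 0, w)
    exact Prod.ext h1 (Prod.ext h2 (Prod.ext h3 h4))
  exact ⟨(LinearEquiv.ofInjectiveOfFinrankEq σ hinj e.finrank_eq.symm).toEquiv, hσ⟩

theorem HasType.extForm_coords {n l m r : ℕ} {g : (Fin n → F) → F} (h : HasType g l m r) :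
    ∃ (f : QuadraticForm F (Fin m → F)) (e : (Fin n → F) ≃ₗ[F] TypeCoords F r l m)
      (τ : TypeCoords F r l m ≃ (Fin n → F)), f.Anisotropic ∧
      ∀ s a v, extForm g (τ s) a v =
        extCoordsForm f s a (LinearEquiv.prodCongr e (LinearEquiv.refl F F) v) := by
  obtain ⟨f, e, hf, he⟩ := h
  obtain ⟨τ, hτ⟩ := exists_equiv_coordsDot e
  refine ⟨f, e, τ, hf, fun s a v => ?_⟩
  simp [extForm, extCoordsForm, hτ, he]

variable [Fintype F] [DecidableEq F]

/-- The average of `u` over the types obtained from a form of type `(m, r)` by adding one variable,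
over a field with `q` elements. -/
noncomputable def typeStep (q : ℝ) (u : ℕ × ℕ → ℝ) (x : ℕ × ℕ) : ℝ :=
  (1 - q⁻¹ ^ x.2) * u (x.1, x.2 - 1) +
    q⁻¹ ^ x.2 * anisotropicStep q (fun y => u (y.1, x.2 + y.2)) x.1

theorem sum_formType_extCoordsForm {r l m : ℕ} (hm : m ≤ 2) {f : QuadraticForm F (Fin m → F)}
    (hf : f.Anisotropic) (u : ℕ × ℕ → ℝ) :
    ∑ s : TypeCoords F r l m, ∑ a, u (formType (extCoordsForm f s a)) =
      (Fintype.card F : ℝ) ^ (r + 2 * l + m + 1) * typeStep (Fintype.card F) u (m, r) := by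
  have hq : (Fintype.card F : ℝ) ≠ 0 := by exact_mod_cast Fintype.card_ne_zero
  have h1 : ∀ x ∈ Finset.univ.erase (0 : Fin r → F),
      ∑ y : (Fin l → F) × (Fin l → F) × (Fin m → F), ∑ a,
        u (formType (extCoordsForm f (x, y) a)) =
      (Fintype.card F : ℝ) ^ (2 * l + m + 1) * u (m, r - 1) := by
    intro x hx
    have : ∀ y a, u (formType (extCoordsForm (l := l) f (x, y) a)) = u (m, r - 1) := fun y a => by
      rw [(hasType_extCoordsForm_of_ne hf (x, y) (Finset.ne_of_mem_erase hx) a).formType_eq hm]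
    simp only [this]
    simp
    ring
  have h2 : ∑ y : (Fin l → F) × (Fin l → F) × (Fin m → F), ∑ a,
        u (formType (extCoordsForm (r := r) f (0, y) a)) =
      (Fintype.card F : ℝ) ^ (2 * l + m + 1) *
        anisotropicStep (Fintype.card F) (fun y => u (y.1, r + y.2)) m := by
    have : ∀ y a, u (formType (extCoordsForm (r := r) (l := l) f (0, y) a)) =
        (fun x : ℕ × ℕ => u (x.1, r + x.2))
          (formType (extForm f y.2.2 (a - y.1 ⬝ᵥ y.2.1))) := fun y a => by
      obtain ⟨l', m', r', hm', h⟩ := exists_hasType_extForm hm hf y.2.2 (a - y.1 ⬝ᵥ y.2.1)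
      rw [(hasType_extCoordsForm_of_eq (r := r) (0, y) rfl a h).formType_eq hm', h.formType_eq hm']
    simp only [this]
    rw [Fintype.sum_prod_type]
    simp only [Fintype.sum_prod_type]
    -- For fixed hyperbolic halves, the correction to `a` is a constant translation and drops out of
    -- the sum over `a`.
    have h3 : ∀ α β : Fin l → F, ∑ μ, ∑ a, (fun x : ℕ × ℕ => u (x.1, r + x.2))
        (formType (extForm f μ (a - α ⬝ᵥ β))) = (Fintype.card F : ℝ) ^ (m + 1) *
        anisotropicStep (Fintype.card F) (fun y => u (y.1, r + y.2)) m := by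
      intro α β
      rw [← sum_formType_extForm_anisotropic hm hf]
      refine Finset.sum_congr rfl fun μ _ => ?_
      exact Equiv.sum_comp (Equiv.subRight (α ⬝ᵥ β)) fun a =>
        (fun x : ℕ × ℕ => u (x.1, r + x.2)) (formType (extForm f μ a))
    simp only [] at h3
    simp only [h3]
    simp
    ring
  rw [Fintype.sum_prod_type, ← Finset.add_sum_erase _ _ (Finset.mem_univ (0 : Fin r → F)), h2,
    Finset.sum_congr rfl h1, Finset.sum_const, Finset.card_erase_of_mem (Finset.mem_univ _),
    Finset.card_univ, nsmul_eq_mul, Nat.cast_sub Fintype.card_pos]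
  simp only [Fintype.card_fun, Fintype.card_fin, typeStep]
  push_cast
  have : (Fintype.card F : ℝ) ^ r * (Fintype.card F : ℝ)⁻¹ ^ r = 1 := by
    rw [← mul_pow, mul_inv_cancel₀ hq, one_pow]
  rw [show r + 2 * l + m + 1 = r + (2 * l + m + 1) by ring, pow_add _ r]
  linear_combination (Fintype.card F : ℝ) ^ (2 * l + m + 1) * (u (m, r - 1) -
    anisotropicStep (Fintype.card F) (fun y => u (y.1, r + y.2)) m) * this

theorem HasType.exists_hasType_extForm {n l m r : ℕ} {g : (Fin n → F) → F} (h : HasType g l m r)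
    (hm : m ≤ 2) (b : Fin n → F) (a : F) :
    ∃ l' m' r', m' ≤ 2 ∧ HasType (extForm g b a) l' m' r' := by
  obtain ⟨f, e, τ, hf, h⟩ := h.extForm_coords
  obtain ⟨s, rfl⟩ := τ.surjective b
  by_cases hs : s.1 = 0
  · obtain ⟨l', m', r', hm', h'⟩ :=
      _root_.exists_hasType_extForm hm hf s.2.2.2 (a - s.2.1 ⬝ᵥ s.2.2.1)
    exact ⟨_, _, _, hm', (hasType_extCoordsForm_of_eq s hs a h').comp_equiv _ (h s a)⟩
  · exact ⟨_, _, _, hm, (hasType_extCoordsForm_of_ne hf s hs a).comp_equiv _ (h s a)⟩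

theorem HasType.sum_formType_extForm {n l m r : ℕ} {g : (Fin n → F) → F} (h : HasType g l m r)
    (hm : m ≤ 2) (u : ℕ × ℕ → ℝ) :
    ∑ b, ∑ a, u (formType (extForm g b a)) =
      (Fintype.card F : ℝ) ^ (n + 1) * typeStep (Fintype.card F) u (m, r) := by
  have hn : n = r + 2 * l + m := by
    rw [← h.finrank_eq]
    simp
  obtain ⟨f, e, τ, hf, h⟩ := h.extForm_coords
  have hc : (Fintype.card F : ℝ) ^ (n + 1) = (Fintype.card F : ℝ) ^ (r + 2 * l + m + 1) := by rw [hn]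
  rw [← Equiv.sum_comp τ, hc, ← sum_formType_extCoordsForm hm hf]
  refine Finset.sum_congr rfl fun s _ => Finset.sum_congr rfl fun a _ => ?_
  by_cases hs : s.1 = 0
  · obtain ⟨l', m', r', hm', h'⟩ :=
      _root_.exists_hasType_extForm hm hf s.2.2.2 (a - s.2.1 ⬝ᵥ s.2.2.1)
    have h2 := hasType_extCoordsForm_of_eq s hs a h'
    rw [h2.formType_eq hm', (h2.comp_equiv _ (h s a)).formType_eq hm']
  · have h2 := hasType_extCoordsForm_of_ne hf s hs a
    rw [h2.formType_eq hm, (h2.comp_equiv _ (h s a)).formType_eq hm]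

end Transition

/-! ### Coefficient families, split by the last variable -/

section Coefficients

variable {F : Type*} [Field F]

theorem QFCoeffs.toForm_apply {n : ℕ} (a : QFCoeffs F n) (x : Fin n → F) :
    a.toForm x = ∑ i, ∑ j, if h : i ≤ j then a ⟨(i, j), h⟩ * (x i * x j) else 0 := by
  rw [QFCoeffs.toForm, sum_apply]
  simp only [smul_apply, QuadraticMap.proj_apply, smul_eq_mul]
  rw [← Fintype.sum_prod_type']
  have h := Finset.sum_subtype (F := inferInstance) (p := fun ij : Fin n × Fin n => ij.1 ≤ ij.2)
    (Finset.univ.filter fun ij => ij.1 ≤ ij.2) (by simp)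
    (fun ij => if h : ij.1 ≤ ij.2 then a ⟨(ij.1, ij.2), h⟩ * (x ij.1 * x ij.2) else 0)
  rw [Finset.sum_filter] at h
  refine Eq.trans (Finset.sum_congr rfl fun ij _ => ?_)
    (h.symm.trans (Finset.sum_congr rfl fun ij _ => ?_))
  · simp [ij.2]
  · split_ifs <;> rfl

/-- The coefficients of a form in `n + 1` variables, split according to whether they involve the
last variable not at all, once, or twice. -/
def QFCoeffs.splitLast (F : Type*) (n : ℕ) :
    QFCoeffs F (n + 1) ≃ QFCoeffs F n × (Fin n → F) × F where
  toFun a := (a.leading n.le_succ, fun i => a ⟨(i.castSucc, Fin.last n), Fin.le_last _⟩,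
    a ⟨(Fin.last n, Fin.last n), le_rfl⟩)
  invFun x ij :=
    if hj : ij.1.2 = Fin.last n then
      if hi : ij.1.1 = Fin.last n then x.2.2 else x.2.1 (ij.1.1.castPred hi)
    else x.1 ⟨(ij.1.1.castPred fun hi => hj (Fin.last_le_iff.1 (hi ▸ ij.2)), ij.1.2.castPred hj),
      ij.2⟩
  left_inv a := by
    ext ⟨⟨i, j⟩, h⟩
    by_cases hj : j = Fin.last n
    · by_cases hi : i = Fin.last n
      · subst hi hj
        simp
      · subst hj
        simp [hi]
    · simp only [hj, dite_false]
      rfl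
  right_inv x := by
    refine Prod.ext ?_ (Prod.ext ?_ ?_)
    · ext ⟨⟨i, j⟩, h⟩
      have : Fin.castLE n.le_succ j ≠ Fin.last n := (Fin.castSucc_lt_last j).ne
      simp [QFCoeffs.leading, this]
      rfl
    · ext i
      simp
    · simp

/-- Splitting off the last coordinate. -/
def splitLastCoord (F : Type*) [Field F] (n : ℕ) : (Fin (n + 1) → F) ≃ₗ[F] (Fin n → F) × F where
  toFun x := (fun i => x i.castSucc, x (Fin.last n))
  map_add' x y := rfl
  map_smul' c x := rfl
  invFun x := Fin.snoc (α := fun _ => F) x.1 x.2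
  left_inv x := by
    ext i
    refine Fin.lastCases ?_ (fun i => ?_) i <;> simp
  right_inv x := by ext <;> simp

theorem QFCoeffs.toForm_splitLast {n : ℕ} (a : QFCoeffs F (n + 1)) (x : Fin (n + 1) → F) :
    a.toForm x = extForm (QFCoeffs.splitLast F n a).1.toForm (QFCoeffs.splitLast F n a).2.1
      (QFCoeffs.splitLast F n a).2.2 (splitLastCoord F n x) := by
  have h (i : Fin n) : ¬ Fin.last n ≤ i.castSucc := not_le.2 (Fin.castSucc_lt_last i)
  rw [QFCoeffs.toForm_apply, extForm, QFCoeffs.toForm_apply]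
  simp only [Fin.sum_univ_castSucc (n := n), Fin.le_last, dite_true, h, dite_false,
    Finset.sum_const_zero, zero_add, Finset.sum_add_distrib]
  simp only [QFCoeffs.splitLast, splitLastCoord, Equiv.coe_fn_mk, LinearEquiv.coe_mk,
    LinearMap.coe_mk, AddHom.coe_mk, dotProduct, Finset.mul_sum]
  congr 1
  · congr 1
    refine Finset.sum_congr rfl fun i _ => ?_
    ring
  · ring

/-- Induction on the number of variables: each extension of a form with a type `m ≤ 2` again has
one. In particular the default value in `formType` is never reached on these forms. -/
theorem QFCoeffs.exists_hasType [Finite F] {n : ℕ} (a : QFCoeffs F n) :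
    ∃ l m r, m ≤ 2 ∧ HasType (V := Fin n → F) a.toForm l m r := by
  classical
  have := Fintype.ofFinite F
  induction n with
  | zero =>
    refine ⟨0, 0, 0, by norm_num, hasType_zero.comp_equiv (LinearEquiv.refl F _) fun v => ?_⟩
    rw [Subsingleton.elim v 0, QuadraticMap.map_zero]
  | succ n ih =>
    obtain ⟨l, m, r, hm, h⟩ := ih (QFCoeffs.splitLast F n a).1
    obtain ⟨l', m', r', hm', h'⟩ := h.exists_hasType_extForm hm (QFCoeffs.splitLast F n a).2.1
      (QFCoeffs.splitLast F n a).2.2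
    exact ⟨l', m', r', hm', h'.comp_equiv _ (QFCoeffs.toForm_splitLast a)⟩

theorem leadingCondition_succ {n i : ℕ} (hi : i ≤ n) (a : QFCoeffs F (n + 1)) :
    LeadingCondition a i ↔ LeadingCondition (QFCoeffs.splitLast F n a).1 i := by
  match i, hi with
  | 0, _ => exact Iff.rfl
  | 1, hi => exact ⟨fun ⟨_, h⟩ => ⟨hi, h⟩, fun ⟨_, h⟩ => ⟨by omega, h⟩⟩
  | 2, hi => exact ⟨fun ⟨_, h⟩ => ⟨hi, h⟩, fun ⟨_, h⟩ => ⟨by omega, h⟩⟩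
  | i + 3, _ => exact Iff.rfl

theorem LeadingCondition.hasType {i : ℕ} {a : QFCoeffs F i} (hi : i ≤ 2)
    (h : LeadingCondition a i) : HasType (V := Fin i → F) a.toForm 0 i 0 := by
  refine hasType_of_anisotropic (f := a.toForm) ?_ (LinearEquiv.refl F _) fun v => rfl
  interval_cases i
  · exact fun x _ => Subsingleton.elim _ _
  · intro x hx
    obtain ⟨_, h⟩ := h
    rw [QFCoeffs.toForm_apply] at hx
    have hx' : a ⟨(0, 0), le_rfl⟩ * (x 0 * x 0) = 0 := by simpa using hx
    ext j
    rw [Subsingleton.elim j 0]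
    exact mul_self_eq_zero.1 ((mul_eq_zero.1 hx').resolve_left h)
  · exact h.2.2

theorem isRegularAnisotropic_iff {k : ℕ} (f : QuadraticForm F (Fin k → F)) :
    IsRegularAnisotropic f ↔ f.Anisotropic := by
  refine ⟨fun h => h.2, fun h => ⟨?_, h⟩⟩
  rw [eq_bot_iff]
  exact fun x hx => h x hx.1

theorem exists_leadingCondition [Finite F] {i : ℕ} (hi : i ≤ 2) :
    ∃ a : QFCoeffs F i, LeadingCondition a i := by
  classical
  have := Fintype.ofFinite F
  interval_cases i
  · exact ⟨fun _ => 0, trivial⟩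
  · exact ⟨fun _ => 1, one_pos, one_ne_zero⟩
  · obtain ⟨b, c, h⟩ : ∃ b c : F, ∀ t, 1 * t ^ 2 + b * t + c ≠ 0 := by
      by_contra! hcon
      -- If every monic quadratic had a root, the hypotheses would hold for `g = 0` with the value
      -- `1` assigned to rootless polynomials; the sum `0` would then equal the positive count of
      -- irreducible ones.
      have := sum_root_count (one_ne_zero (α := F)) 1 0 0 (fun _ _ => 0)
        (fun b a h => by
          obtain ⟨t, ht⟩ := hcon b a
          exact absurd ht (h t)) (fun b a t _ => by simp)
      have hq : (1 : ℝ) < Fintype.card F := by exact_mod_cast Fintype.one_lt_card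
      simp only [Finset.sum_const_zero] at this
      nlinarith
    refine ⟨fun ij => if ij.1.1 = ij.1.2 then (if ij.1.1 = 0 then 1 else c) else b, le_rfl, ?_⟩
    rw [isRegularAnisotropic_iff]
    intro x hx
    have hx' : x 0 * x 0 + b * (x 0 * x 1) + c * (x 1 * x 1) = 0 := by
      rw [QFCoeffs.toForm_apply] at hx
      simpa [Fin.sum_univ_two, QFCoeffs.leading] using hx
    have h1 : x 1 = 0 := by
      by_contra h1
      refine h (x 0 / x 1) ?_
      field_simp
      linear_combination hx'
    have h0 : x 0 = 0 := by simpa [h1] using hx'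
    ext j
    fin_cases j
    · exact h0
    · exact h1

end Coefficients

/-! ### Classes, and class probabilities as iterates of the transition operator -/

section Classes

open Matrix

variable {F : Type*} [Field F]

theorem exists_splitForm_coords {l m n : ℕ} (h : 2 * l + m ≤ n) :
    ∃ e : (Fin n → F) ≃ₗ[F] TypeCoords F (n - 2 * l - m) l m,
      ∀ (f : QuadraticForm F (Fin m → F)) (x : Fin n → F),
        splitForm l m n h f x = (e x).2.1 ⬝ᵥ (e x).2.2.1 + f (e x).2.2.2 := by
  let φ : (Fin n → F) →ₗ[F] TypeCoords F (n - 2 * l - m) l m :=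
    { toFun := fun x => (fun i => x ⟨i, by omega⟩, fun k => x ⟨n - 2 * l - m + 2 * k, by omega⟩,
        fun k => x ⟨n - 2 * l - m + 2 * k + 1, by omega⟩,
        fun t => x ⟨n - 2 * l - m + 2 * l + t, by omega⟩)
      map_add' := fun x y => rfl
      map_smul' := fun c x => rfl }
  have hφ : Function.Injective φ := by
    rw [← LinearMap.ker_eq_bot, LinearMap.ker_eq_bot']
    intro x hx
    have h1 (i : ℕ) (hi : i < n - 2 * l - m) : x ⟨i, by omega⟩ = 0 :=
      congrFun (congrArg Prod.fst hx) ⟨i, hi⟩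
    have h2 (k : ℕ) (hk : k < l) : x ⟨n - 2 * l - m + 2 * k, by omega⟩ = 0 :=
      congrFun (congrArg (fun y => y.2.1) hx) ⟨k, hk⟩
    have h3 (k : ℕ) (hk : k < l) : x ⟨n - 2 * l - m + 2 * k + 1, by omega⟩ = 0 :=
      congrFun (congrArg (fun y => y.2.2.1) hx) ⟨k, hk⟩
    have h4 (t : ℕ) (ht : t < m) : x ⟨n - 2 * l - m + 2 * l + t, by omega⟩ = 0 :=
      congrFun (congrArg (fun y => y.2.2.2) hx) ⟨t, ht⟩
    ext ⟨i, hi⟩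
    by_cases c1 : i < n - 2 * l - m
    · exact h1 i c1
    by_cases c2 : i < n - 2 * l - m + 2 * l
    · obtain ⟨k, hk | hk⟩ : ∃ k, i = n - 2 * l - m + 2 * k ∨ i = n - 2 * l - m + 2 * k + 1 :=
        ⟨(i - (n - 2 * l - m)) / 2, by omega⟩
      · subst hk
        exact h2 k (by omega)
      · subst hk
        exact h3 k (by omega)
    · obtain ⟨t, rfl⟩ : ∃ t, i = n - 2 * l - m + 2 * l + t :=
        ⟨i - (n - 2 * l - m + 2 * l), by omega⟩
      exact h4 t (by omega)
  refine ⟨LinearEquiv.ofInjectiveOfFinrankEq φ hφ (by simp; omega), fun f x => ?_⟩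
  rw [splitForm, _root_.add_apply, _root_.sum_apply, QuadraticMap.comp_apply]
  rfl

theorem inClass_iff {l m n : ℕ} (Q : QuadraticForm F (Fin n → F)) :
    InClass l m n Q ↔ 2 * l + m ≤ n ∧ HasType (V := Fin n → F) Q l m (n - 2 * l - m) := by
  constructor
  · rintro ⟨h, f, hf, ⟨E⟩⟩
    obtain ⟨e, he⟩ := exists_splitForm_coords (F := F) h
    exact ⟨h, f, E.toLinearEquiv ≪≫ₗ e, hf.2, fun v => by
      rw [← E.map_app, he]; rfl⟩
  · rintro ⟨h, f, e', hf, h'⟩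
    obtain ⟨e, he⟩ := exists_splitForm_coords (F := F) h
    exact ⟨h, f, (isRegularAnisotropic_iff f).2 hf, ⟨{ e' ≪≫ₗ e.symm with
      map_app' := fun v => by
        rw [he, h']
        simp }⟩⟩

variable [Fintype F]

open Classical in
/-- The sum of `u` over the types of the forms in `n` variables that satisfy the leading
condition with index `i`. -/
noncomputable def typeSum (F : Type*) [Field F] [Fintype F] (i n : ℕ) (u : ℕ × ℕ → ℝ) : ℝ :=
  ∑ a : QFCoeffs F n, if LeadingCondition a i then u (formType (V := Fin n → F) a.toForm) else 0

/-- For `i ≤ n` the leading condition does not involve the last variable, so the sum over the new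
coefficients can be carried out for each form separately. -/
theorem typeSum_succ [DecidableEq F] {i n : ℕ} (hi : i ≤ n) (u : ℕ × ℕ → ℝ) :
    typeSum F i (n + 1) u =
      (Fintype.card F : ℝ) ^ (n + 1) * typeSum F i n (typeStep (Fintype.card F) u) := by
  classical
  rw [typeSum, ← Equiv.sum_comp (QFCoeffs.splitLast F n).symm, Fintype.sum_prod_type, typeSum,
    Finset.mul_sum]
  refine Finset.sum_congr rfl fun a _ => ?_
  obtain ⟨l, m, r, hm, h⟩ := a.exists_hasType
  have key : ∀ x, formType (V := Fin (n + 1) → F)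
      ((QFCoeffs.splitLast F n).symm (a, x)).toForm = formType (extForm a.toForm x.1 x.2) := by
    intro x
    obtain ⟨l', m', r', hm', h'⟩ := h.exists_hasType_extForm hm x.1 x.2
    rw [h'.formType_eq hm', (h'.comp_equiv (splitLastCoord F n) fun v => ?_).formType_eq hm']
    rw [QFCoeffs.toForm_splitLast, Equiv.apply_symm_apply]
  simp only [leadingCondition_succ hi, Equiv.apply_symm_apply, key]
  split_ifs
  · rw [Fintype.sum_prod_type, h.sum_formType_extForm hm, h.formType_eq hm]
  · simp

theorem typeSum_self {i : ℕ} (hi : i ≤ 2) (u : ℕ × ℕ → ℝ) :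
    typeSum F i i u = typeSum F i i 1 * u (i, 0) := by
  classical
  rw [typeSum, typeSum, Finset.sum_mul]
  refine Finset.sum_congr rfl fun a _ => ?_
  split_ifs with h
  · rw [(h.hasType hi).formType_eq hi, Pi.one_apply, one_mul]
  · rw [zero_mul]

theorem typeStep_one : typeStep (Fintype.card F) 1 = 1 := by
  have hq : (Fintype.card F : ℝ) ≠ 0 := by exact_mod_cast Fintype.card_ne_zero
  ext x
  simp only [typeStep, anisotropicStep, Pi.one_apply]
  split_ifs <;> ring

/-- The chain starts at `n = i`, where the leading condition forces the type `(i, 0)`. The factor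
`typeSum F i n 1` counts the admissible forms, so dividing by it gives a conditional expectation. -/
theorem typeSum_eq [DecidableEq F] {i n : ℕ} (hi : i ≤ 2) (hn : i ≤ n) (u : ℕ × ℕ → ℝ) :
    typeSum F i n u = typeSum F i n 1 * (typeStep (Fintype.card F))^[n - i] u (i, 0) := by
  induction n, hn using Nat.le_induction generalizing u with
  | base => rw [typeSum_self hi, Nat.sub_self, Function.iterate_zero, id]
  | succ n hn ih =>
    rw [typeSum_succ hn, ih, typeSum_succ hn, typeStep_one, mul_assoc, Nat.succ_sub hn,
      Function.iterate_succ_apply]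

theorem typeSum_one_pos [DecidableEq F] {i n : ℕ} (hi : i ≤ 2) (hn : i ≤ n) : 0 < typeSum F i n 1 := by
  classical
  induction n, hn using Nat.le_induction with
  | base =>
    obtain ⟨a, ha⟩ := exists_leadingCondition (F := F) hi
    refine Finset.sum_pos' (fun b _ => ?_) ⟨a, Finset.mem_univ _, by simp [ha]⟩
    split_ifs
    · exact zero_le_one
    · exact le_rfl
  | succ n hn ih =>
    rw [typeSum_succ hn, typeStep_one]
    have hq : (0 : ℝ) < Fintype.card F := by exact_mod_cast Fintype.card_pos
    positivity

end Classes

open Classical in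
theorem hasSum_classProb (p : ℕ) [Fact p.Prime] {i n : ℕ} (hi : i ≤ 2) (hn : i ≤ n)
    (W : ℕ → ℕ → ℝ) (u : ℕ × ℕ → ℝ)
    (hW : ∀ l m, m ≤ 2 → 2 * l + m ≤ n → W l m = u (m, n - 2 * l - m)) :
    HasSum (fun l : ℕ => ∑ m ∈ Finset.range 3, classProb p i l m n * W l m)
      ((typeStep p)^[n - i] u (i, 0)) := by
  have hpos := typeSum_one_pos (F := ZMod p) hi hn
  have hcard : (Nat.card {a : QFCoeffs (ZMod p) n // LeadingCondition a i} : ℝ) =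
      typeSum (ZMod p) i n 1 := by
    rw [typeSum, Nat.card_eq_fintype_card, Fintype.card_subtype, Finset.card_filter]
    simp
  have hprob (l m : ℕ) : classProb p i l m n * W l m = (∑ a : QFCoeffs (ZMod p) n,
      if LeadingCondition a i then (if InClass l m n a.toForm then W l m else 0) else 0) /
        typeSum (ZMod p) i n 1 := by
    rw [classProb, hcard, Nat.card_eq_fintype_card, Fintype.card_subtype, Finset.card_filter,
      div_mul_eq_mul_div, Nat.cast_sum, Finset.sum_mul]
    congr 1
    refine Finset.sum_congr rfl fun a _ => ?_
    by_cases h1 : LeadingCondition a i <;> by_cases h2 : InClass l m n a.toForm <;> simp [h1, h2]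
  have hzero (l : ℕ) (hl : l ∉ Finset.range (n + 1)) :
      ∑ m ∈ Finset.range 3, classProb p i l m n * W l m = 0 := by
    refine Finset.sum_eq_zero fun m _ => ?_
    rw [hprob, Finset.sum_eq_zero, zero_div]
    intro a _
    have hnot : ¬ InClass l m n a.toForm := fun h => by
      have := ((inClass_iff _).1 h).1
      rw [Finset.mem_range] at hl
      omega
    rw [if_neg hnot, ite_self]
  have hmain : ∑ l ∈ Finset.range (n + 1), ∑ m ∈ Finset.range 3, classProb p i l m n * W l m =
      (typeStep p)^[n - i] u (i, 0) := by
    have h1 := typeSum_eq (F := ZMod p) hi hn u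
    rw [ZMod.card] at h1
    rw [eq_comm, ← mul_right_inj' hpos.ne', ← h1, typeSum]
    simp only [hprob, ← Finset.sum_div]
    rw [mul_div_cancel₀ _ hpos.ne', Finset.sum_congr rfl fun l _ => Finset.sum_comm,
      Finset.sum_comm]
    refine Finset.sum_congr rfl fun a _ => ?_
    split_ifs
    · obtain ⟨l, m, r, hm, h⟩ := a.exists_hasType
      have hd : n = r + 2 * l + m := by
        rw [← h.finrank_eq]
        simp
      have hr : r = n - 2 * l - m := by omega
      have hin : InClass l m n a.toForm := (inClass_iff _).2 ⟨by omega, hr ▸ h⟩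
      -- Each form lies in exactly one class with `m ≤ 2`, so the double sum over classes collapses
      -- to a single term.
      have huniq : ∀ l' m', m' ≤ 2 → InClass l' m' n a.toForm → l' = l ∧ m' = m := by
        intro l' m' hm' h'
        have := ((inClass_iff _).1 h').2.unique h hm' hm
        exact ⟨this.1, this.2.1⟩
      rw [Finset.sum_eq_single l, Finset.sum_eq_single m, if_pos hin, hW l m hm (by omega),
        h.formType_eq hm, hr]
      · intro m' hm' hne
        rw [if_neg fun h' => hne (huniq l m' (by rw [Finset.mem_range] at hm'; omega) h').2]
      · intro h'
        rw [Finset.mem_range] at h'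
        omega
      · intro l' _ hne
        refine Finset.sum_eq_zero fun m' hm' => ?_
        rw [if_neg fun h' => hne (huniq l' m' (by rw [Finset.mem_range] at hm'; omega) h').1]
      · intro h'
        rw [Finset.mem_range] at h'
        omega
    · simp
  rw [← hmain]
  exact hasSum_sum_of_ne_finset_zero hzero

/-! ### Decoupling the two variables, and the shape of φ -/

/-- In the `B` part, moves to `m = 1` contribute zero, and from `m = 1` the moves to `0` and `2`
cancel; only moves keeping `m` survive. In the `A` part `m` plays no role. -/
theorem typeStep_iterate {q : ℝ} {u : ℕ × ℕ → ℝ} {A B : ℕ → ℝ}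
    (hu : ∀ m r, m ≤ 2 → u (m, r) = A r + ((m : ℝ) - 1) * B r) (t : ℕ) (m r : ℕ) (hm : m ≤ 2) :
    (typeStep q)^[t] u (m, r) =
      ((radStep q⁻¹) ^ t) A r + ((m : ℝ) - 1) * ((altStep q⁻¹) ^ t) B r := by
  induction t generalizing u A B with
  | zero => exact hu m r hm
  | succ t ih =>
    rw [Function.iterate_succ_apply, pow_succ, pow_succ, Module.End.mul_apply, Module.End.mul_apply]
    refine ih fun m r hm => ?_
    rw [typeStep, anisotropicStep, radStep_apply, altStep_apply]
    simp only [hu _ _ hm, hu _ _ (zero_le_two), hu _ _ one_le_two, hu _ _ le_rfl, add_zero]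
    interval_cases m
    · norm_num
      ring
    · norm_num
      ring
    · norm_num
      ring

theorem phiFun_eq (p : ℝ) (i j t : ℕ) :
    phiFun p i j (t + i + j) = ((j : ℝ) - 1) * (p ^ ((t + 1) / 2) * oddEvenProd p ((t + 1) / 2)) +
      ((i : ℝ) - 1) * oddEvenProd p ((t + 1) / 2) := by
  have : t + i + j + 1 - i - j = t + 1 := by omega
  simp only [phiFun, this, oddEvenProd]
  ring

/-! ### Decomposition of ψ -/

section Psi

variable {p : ℝ}

theorem parityGeom_inv_even (hp : 0 < p) (hp1 : p ≠ 1) (d : ℕ) :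
    parityGeom p⁻¹ (2 * d) = -1 / (p ^ (2 * d + 1) - 1) := by
  have h : p ^ (2 * d + 1) - 1 ≠ 0 := pow_sub_one_ne_zero hp hp1 (by omega)
  have h0 : p ^ (2 * d + 1) ≠ 0 := by positivity
  rw [parityGeom, if_pos (even_two_mul d), ← pow_succ', inv_pow]
  generalize p ^ (2 * d + 1) = X at *
  have : 1 - X⁻¹ ≠ 0 := by
    intro h'
    apply h
    field_simp at h'
    simpa using h'
  field_simp

theorem parityGeom_odd (q : ℝ) (d : ℕ) : parityGeom q (2 * d + 1) = 1 := by
  rw [parityGeom, if_neg (Nat.not_even_bit1 d)]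

theorem halfGeom_inv_even (hp : 0 < p) (hp1 : p ≠ 1) (d : ℕ) :
    halfGeom p⁻¹ (2 * d) = p ^ d / (p ^ (2 * d + 1) - 1) := by
  have h : p ^ (2 * d + 1) - 1 ≠ 0 := pow_sub_one_ne_zero hp hp1 (by omega)
  have h' : 1 - p⁻¹ ^ (2 * d + 1) ≠ 0 :=
    one_sub_pow_ne_zero (inv_pos.2 hp) (by simpa using hp1) (by omega)
  have e : p ^ (2 * d + 1) * p⁻¹ ^ (d + 1) = p ^ d := by
    rw [show 2 * d + 1 = d + (d + 1) by ring, pow_add, mul_assoc, ← mul_pow,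
      mul_inv_cancel₀ hp.ne', one_pow, mul_one]
  have e2 : p ^ d * p⁻¹ ^ (2 * d + 1) = p⁻¹ ^ (d + 1) := by
    rw [show 2 * d + 1 = d + (d + 1) by ring, pow_add p⁻¹, ← mul_assoc, ← mul_pow,
      mul_inv_cancel₀ hp.ne', one_pow, one_mul]
  rw [halfGeom_even, div_eq_div_iff h' h]
  linear_combination e + e2

/-- The part of `psiFun p j m` that depends on `m` only through its parity, as a function of the
dimension `r` of the radical. -/
noncomputable def psiEvenPart (p : ℝ) (j : ℕ) : ℕ → ℝ :=
  if j = 1 then (1 / (p + 1)) • (1 + (p - 1) • parityGeom p⁻¹)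
  else (1 / (p + 1)) • (p • 1 - (p - 1) • parityGeom p⁻¹)

/-- The part of `psiFun p j m` that is odd in `m - 1`, as a function of the dimension `r` of the
radical. -/
noncomputable def psiOddPart (p : ℝ) (j : ℕ) : ℕ → ℝ :=
  if j = 1 then 0 else (((j : ℝ) - 1) * (p - 1)) • halfGeom p⁻¹

theorem psiFun_add (p : ℝ) (i j t : ℕ) :
    psiFun p i j (t + i + j) =
      ((((j : ℝ) - 1) * p ^ ((t + 1) / 2) + ((i : ℝ) - 1)) *
        (((j : ℝ) - 1) * p ^ ((t + 1) / 2 + 2) - ((i : ℝ) - 1))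
        - (if i = 1 then 1 else 0) * p + (if j = 1 then 1 else 0) * p ^ (2 * ((t + 1) / 2) + 1)) /
      ((p + 1) * (p ^ (2 * ((t + 1) / 2) + 1) - 1)) := by
  have : t + i + j + 1 - i - j = t + 1 := by omega
  simp only [psiFun, this]

/-- Since `r + j + m` is even, the parity of `m` can be read off from `r`, and a dependence on that
parity becomes part of a function of `r`. For odd `r` one of `j`, `m` equals `1`, so the odd part
contributes nothing and `halfGeom` matters only at even arguments. -/
theorem psiFun_eq_parts (hp : 1 < p) {j m r : ℕ} (hj : j ≤ 2) (hm : m ≤ 2)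
    (hpar : Even (r + j + m)) :
    psiFun p j m (r + j + m) = psiEvenPart p j r + ((m : ℝ) - 1) * psiOddPart p j r := by
  have hp0 : 0 < p := by linarith
  have hp1 : p + 1 ≠ 0 := by linarith
  rw [psiFun_add]
  obtain ⟨d, rfl | rfl⟩ : ∃ d, r = 2 * d ∨ r = 2 * d + 1 := ⟨r / 2, by omega⟩
  · have h : p ^ (2 * d + 1) - 1 ≠ 0 := pow_sub_one_ne_zero hp0 hp.ne' (by omega)
    have hd : (2 * d + 1) / 2 = d := by omega
    rw [Nat.even_iff] at hpar
    interval_cases j <;> interval_cases m <;> first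
      | omega
      | simp [psiEvenPart, psiOddPart, parityGeom_inv_even hp0 hp.ne',
          halfGeom_inv_even hp0 hp.ne', hd]
        field_simp
        ring
  · have h : p ^ (2 * d + 3) - 1 ≠ 0 := pow_sub_one_ne_zero hp0 hp.ne' (by omega)
    have hd : (2 * d + 1 + 1) / 2 = d + 1 := by omega
    rw [Nat.even_iff] at hpar
    rw [hd, show 2 * (d + 1) + 1 = 2 * d + 3 by ring]
    interval_cases j <;> interval_cases m <;> first
      | omega
      | simp [psiEvenPart, psiOddPart, parityGeom_odd]
        field_simp
        ring

theorem radStep_one (q : ℝ) : radStep q 1 = 1 := by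
  ext r
  simp only [radStep_apply, Pi.one_apply]
  ring

theorem radStep_pow_one (q : ℝ) (t : ℕ) : ((radStep q) ^ t) 1 = 1 := by
  induction t with
  | zero => rfl
  | succ t ih => rw [pow_succ, Module.End.mul_apply, radStep_one, ih]

/-- Constants are fixed by `radStep`, and `parityGeom` and `halfGeom` have known iterates. For odd
`t` one of `i`, `j` equals `1`, so no odd iterate of `halfGeom` is needed. -/
theorem psiFun_eq_pow_parts (hp : 1 < p) {i j t : ℕ} (hi : i ≤ 2) (hj : j ≤ 2)
    (hpar : Even (t + i + j)) :
    psiFun p i j (t + i + j) = ((radStep p⁻¹) ^ t) (psiEvenPart p j) 0 +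
      ((i : ℝ) - 1) * ((altStep p⁻¹) ^ t) (psiOddPart p j) 0 := by
  have hp0 : 0 < p := by linarith
  have hp1 : p + 1 ≠ 0 := by linarith
  have hq : 0 < p⁻¹ := inv_pos.2 hp0
  have hq1 : p⁻¹ < 1 := inv_lt_one_of_one_lt₀ hp
  rw [psiFun_add]
  obtain ⟨d, rfl | rfl⟩ : ∃ d, t = 2 * d ∨ t = 2 * d + 1 := ⟨t / 2, by omega⟩
  · have h : p ^ (2 * d + 1) - 1 ≠ 0 := pow_sub_one_ne_zero hp0 hp.ne' (by omega)
    have hd : (2 * d + 1) / 2 = d := by omega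
    have hpg : ((radStep p⁻¹) ^ (2 * d)) (parityGeom p⁻¹) 0 = -1 / (p ^ (2 * d + 1) - 1) := by
      rw [← parityGeom_inv_even hp0 hp.ne', radStep_pow_parityGeom hq hq1, parityGeom,
        if_pos (even_two_mul d), if_pos (even_two_mul d)]
    have hhg : ((altStep p⁻¹) ^ (2 * d)) (halfGeom p⁻¹) 0 = p ^ d / (p ^ (2 * d + 1) - 1) := by
      rw [altStep_pow_halfGeom hq hq1.ne, halfGeom_inv_even hp0 hp.ne']
    rw [Nat.even_iff] at hpar
    interval_cases j <;> interval_cases i <;> first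
      | omega
      | simp [psiEvenPart, psiOddPart, radStep_pow_one, hpg, hhg, hd, map_sub, map_add, map_smul]
        field_simp
        ring
  · have h : p ^ (2 * d + 3) - 1 ≠ 0 := pow_sub_one_ne_zero hp0 hp.ne' (by omega)
    have hd : (2 * d + 1 + 1) / 2 = d + 1 := by omega
    have hpg : ((radStep p⁻¹) ^ (2 * d + 1)) (parityGeom p⁻¹) 0 = 0 := by
      rw [radStep_pow_parityGeom hq hq1, if_neg (Nat.not_even_bit1 d)]
    rw [Nat.even_iff] at hpar
    rw [hd, show 2 * (d + 1) + 1 = 2 * d + 3 by ring]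
    interval_cases j <;> interval_cases i <;> first
      | omega
      | simp [psiEvenPart, psiOddPart, radStep_pow_one, hpg, map_sub, map_add, map_smul]
        field_simp
        ring

end Psi

theorem mainTheorem7 (p : ℕ) [Fact p.Prime] (i j n : ℕ) (hi : i ≤ 2) (hj : j ≤ 2)
    (hn : i + j ≤ n) :
    HasSum (fun l : ℕ => ∑ m ∈ Finset.range 3,
        classProb p i l m (n - j) * phiFun p j m (n - 2 * l)) (phiFun p i j n) ∧
    (Even n → HasSum (fun l : ℕ => ∑ m ∈ Finset.range 3,
        classProb p i l m (n - j) * psiFun p j m (n - 2 * l)) (psiFun p i j n)) := by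
  have hp1 : (1 : ℝ) < p := by exact_mod_cast (Fact.out : p.Prime).one_lt
  have hp0 : (0 : ℝ) < p := by linarith
  obtain ⟨t, rfl⟩ : ∃ t, n = t + i + j := ⟨n - i - j, by omega⟩
  have ht : t + i + j - j - i = t := by omega
  constructor
  -- With `r` the dimension of the radical, `n - 2 * l = r + j + m`. This exhibits φ with `A` and
  -- `B` given by the product without and with the power of `p`; the iteration exchanges these two,
  -- which matches the roles of `i` and `j` in the result.
  · have h := hasSum_classProb p hi (n := t + i + j - j) (by omega)
      (fun l m => phiFun p j m (t + i + j - 2 * l))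
      (fun x => ((j : ℝ) - 1) * ceilProd p x.2 + ((x.1 : ℝ) - 1) *
        ((p : ℝ) ^ ((x.2 + 1) / 2) * oddEvenProd p ((x.2 + 1) / 2))) (fun l m _ hlm => by
          obtain ⟨r, hr⟩ : ∃ r, t + i + j - j - 2 * l - m = r := ⟨_, rfl⟩
          rw [show t + i + j - 2 * l = r + j + m by omega, phiFun_eq, hr, ceilProd]
          ring)
    rw [ht, typeStep_iterate (A := ((j : ℝ) - 1) • ceilProd p)
      (B := fun r => (p : ℝ) ^ ((r + 1) / 2) * oddEvenProd p ((r + 1) / 2))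
      (fun _ _ _ => rfl) _ _ _ hi, map_smul, Pi.smul_apply, smul_eq_mul,
      radStep_pow_ceilProd hp0 hp1.ne', altStep_pow_ceilProd_inv hp0 hp1.ne', ← phiFun_eq] at h
    exact h
  · intro hpar
    have h := hasSum_classProb p hi (n := t + i + j - j) (by omega)
      (fun l m => psiFun p j m (t + i + j - 2 * l))
      (fun x => psiEvenPart p j x.2 + ((x.1 : ℝ) - 1) * psiOddPart p j x.2) (fun l m hm hlm => by
          obtain ⟨r, hr⟩ : ∃ r, t + i + j - j - 2 * l - m = r := ⟨_, rfl⟩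
          have hr' : t + i + j - 2 * l = r + j + m := by omega
          rw [hr', hr, psiFun_eq_parts hp1 hj hm]
          rw [Nat.even_iff] at hpar ⊢
          omega)
    rw [ht, typeStep_iterate (fun _ _ _ => rfl) _ _ _ hi,
      ← psiFun_eq_pow_parts hp1 hi hj hpar] at h
    exact h
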